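/- Let $K$ be a field of characteristic zero and let $X$ be a smooth projective variety over $K$ (an integral scheme, smooth over $K$, admitting a closed immersion over $K$ into some $\mathbb P^N_K$). For nonzero rational functions $f_1,\dots,f_n\in K(X)^\times$ let $\operatorname{supp}((f_1),\dots,(f_n))$ denote the reduced divisor on $X$ whose components are the prime divisors $D$ with $\operatorname{ord}_D(f_i)\neq 0$ for at least one $i$. Call $(f_1,\dots,f_n)$ weakly admissible if $\operatorname{supp}((f_1),\dots,(f_n))$ is a simple normal crossing divisor, that is, every point $x\in X$ has a regular system of parameters of $\mathcal O_{X,x}$ such that the components through $x$ are defined at $x$ by pairwise distinct members of it. Call it strictly admissible if it is weakly admissible and no two of the divisors $(f_1),\dots,(f_n)$ have a common component: for $i\neq j$ there is no prime divisor $D$ with $\operatorname{ord}_D(f_i)\neq 0$ and $\operatorname{ord}_D(f_j)\neq 0$. If $(f_1,\dots,f_n)$ is weakly admissible, then the element $f_1\wedge\dots\wedge f_n$ of the $\mathbb Q$-vector space $\Lambda^n(K(X)^\times\otimes_{\mathbb Z}\mathbb Q)$ is a finite $\mathbb Q$-linear combination of elements $g_1\wedge\dots\wedge g_n$ with $g_1,\dots,g_n\in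 K(X)^\times$ such that $(g_1,\dots,g_n)$ is strictly admissible. -/

import Mathlib

open AlgebraicGeometry CategoryTheory TensorProduct

universe u

noncomputable section

section ProjectiveSpace

attribute [local instance] MvPolynomial.gradedAlgebra

/-- Projective space of dimension `N` over a field `K`: `Proj K[x₀, …, x_N]` with the standard
grading. -/
def projectiveSpace (K : Type u) [Field K] (N : ℕ) : Scheme.{u} :=
  Proj (MvPolynomial.homogeneousSubmodule (Fin (N + 1)) K)

/-- The structure morphism of projective space to the spectrum of the base field. -/
def projectiveSpaceToSpec (K : Type u) [Field K] (N : ℕ) :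
    projectiveSpace K N ⟶ Spec (CommRingCat.of K) :=
  Proj.toSpecZero (MvPolynomial.homogeneousSubmodule (Fin (N + 1)) K) ≫
    Spec.map (CommRingCat.ofHom
      (algebraMap K (MvPolynomial.homogeneousSubmodule (Fin (N + 1)) K 0)))

end ProjectiveSpace

/-- A smooth projective variety over a field `K`: an integral scheme, smooth over `K`, which admits
a closed immersion over `K` into some projective space over `K`. -/
structure SmoothProjectiveVariety (K : Type u) [Field K] where
  /-- The underlying scheme. -/
  X : Scheme.{u}
  /-- The structure morphism. -/
  toSpec : X ⟶ Spec (CommRingCat.of K)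
  isIntegral : IsIntegral X
  smooth : Smooth toSpec
  projective : ∃ (N : ℕ) (i : X ⟶ projectiveSpace K N),
    IsClosedImmersion i ∧ i ≫ projectiveSpaceToSpec K N = toSpec

attribute [instance] SmoothProjectiveVariety.isIntegral SmoothProjectiveVariety.smooth

instance SmoothProjectiveVariety.isLocallyNoetherian {K : Type u} [Field K]
    (V : SmoothProjectiveVariety K) : IsLocallyNoetherian V.X :=
  LocallyOfFiniteType.isLocallyNoetherian V.toSpec

section Divisors

variable {X : Scheme.{u}}

/-- The prime ideal of the local ring `𝒪_{X,x}` that corresponds to the generization `z` of `x`,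
that is, the ideal of germs at `x` of functions vanishing on the closure of `z`. -/
def idealOfGenerization {x z : X} (h : z ⤳ x) : Ideal (X.presheaf.stalk x) :=
  (IsLocalRing.maximalIdeal (X.presheaf.stalk z)).comap (X.presheaf.stalkSpecializes h).hom

/-- Prime divisors are represented by their generic points, and a reduced divisor by the set `S`
of generic points of its components. The divisor has simple normal crossings if every point `x`
has a regular system of parameters `t₁, …, t_d` of `𝒪_{X,x}` (generators of the maximal ideal, in
number equal to the Krull dimension) such that the components through `x` are defined at `x` by
pairwise distinct members of it. -/
def IsSimpleNormalCrossing (S : Set X) : Prop :=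
  ∀ x : X, ∃ (d : ℕ) (t : Fin d → X.presheaf.stalk x),
    ringKrullDim (X.presheaf.stalk x) = d ∧
    Ideal.span (Set.range t) = IsLocalRing.maximalIdeal (X.presheaf.stalk x) ∧
    ∃ c : {z : X // z ∈ S ∧ z ⤳ x} → Fin d, Function.Injective c ∧
      ∀ z, idealOfGenerization z.2.2 = Ideal.span {t (c z)}

variable [IsIntegral X] [IsLocallyNoetherian X]

/-- The components of the divisor `(f)` of a nonzero rational function `f`, given by their generic
points: the points of codimension one at which the order of `f` is not zero (`Scheme.ord` vanishes
at the points of other codimension). -/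
def divisorSupport (f : X.functionFieldˣ) : Set X :=
  {z | Scheme.ord (f : X.functionField) z ≠ 0}

/-- The support `supp((f₁), …, (fₙ))` is a simple normal crossing divisor. -/
def WeaklyAdmissible {n : ℕ} (f : Fin n → X.functionFieldˣ) : Prop :=
  IsSimpleNormalCrossing (⋃ i, divisorSupport (f i))

/-- A weakly admissible sequence such that no two of the divisors `(f₁), …, (fₙ)` have a common
component. -/
def StrictlyAdmissible {n : ℕ} (f : Fin n → X.functionFieldˣ) : Prop :=
  WeaklyAdmissible f ∧
    Pairwise fun i j => Disjoint (divisorSupport (f i)) (divisorSupport (f j))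

end Divisors

/-- The `ℚ`-vector space `Λⁿ(F^× ⊗ ℚ)`, where `F^×` is the group of units of `F`, written
additively. -/
abbrev RationalWedge (F : Type u) [CommRing F] (n : ℕ) : Type u :=
  ⋀[ℚ]^n (ℚ ⊗[ℤ] Additive Fˣ)

/-- The element `f₁ ∧ ⋯ ∧ fₙ` of `Λⁿ(F^× ⊗ ℚ)`. -/
def wedge {F : Type u} [CommRing F] {n : ℕ} (f : Fin n → Fˣ) : RationalWedge F n :=
  exteriorPower.ιMulti ℚ n fun i => (1 : ℚ) ⊗ₜ[ℤ] Additive.ofMul (f i)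

end

/-! Call a triple (i, j, D) with D a common component of (f_i) and (f_j) an overlap. The proof is an
induction on the number of overlaps (`mem_span_of_moving`). Let D be common to (f_i) and (f_j), and
let h be a function with ord_D h ≠ 0 all of whose other zeros and poles avoid those of the other
f_q. The function f_i^(ord_D h) / h^(ord_D f_i) has order 0 at D, and putting it in place of f_i
removes an overlap and creates none. Hence, modulo products with fewer overlaps, f_i may be
exchanged for h up to a nonzero rational factor (`exists_exchange`). With three such functions h₁,
h₂, h₃ that pairwise share only D, the product becomes a multiple of h₁ ∧ h₂ ∧ ⋯. Further exchanges
lead through h₃ ∧ h₂ and h₃ ∧ h₁ to h₂ ∧ h₁ = -h₁ ∧ h₂, so 2 ord_D(h₃) · h₁ ∧ h₂ ∧ ⋯ is a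
combination of products with fewer overlaps.

The functions h come from a moving lemma (`HomogeneousCoordinates.exists_moving`). In a projective
embedding take h = g / ℓ^m, where ℓ is a general linear form and g a general member of a system of
forms of degree m that cuts out D. Locally D has one equation, being a component of a normal
crossing divisor, so D splits off as the fixed part of the system and the rest has no base points.
The zeros and poles of h other than D lie in the movable parts of the divisors of g and ℓ, and by
Bertini's theorem these cross any prescribed normal crossing divisor normally and share no component
with it.

Bertini's theorem is proved by differentiating with respect to a parameter. If a member with
algebraically independent parameters were tangent to a stratum, the derivation sending one parameter
to 1 and the others to 0 would turn the tangency equations into 1 = 0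
(`AlgebraicIndependent.not_tangent`). So the bad parameters satisfy a nonzero polynomial, which some
point over the infinite field K avoids. The normal crossing condition supplies the regular systems
of parameters into which the new local equation is exchanged. -/

noncomputable section

/-! ### Derivations and algebraic independence in characteristic zero -/

open TensorProduct in
/-- Derivations extend along formally étale algebras. -/
theorem Derivation.exists_extension_of_formallyEtale {K A E : Type*} [CommRing K] [CommRing A]
    [CommRing E] [Algebra K A] [Algebra K E] [Algebra A E] [IsScalarTower K A E]
    [Algebra.FormallyEtale A E] (D₀ : Derivation K A E) :
    ∃ δ : Derivation K E E, ∀ a, δ (algebraMap A E a) = D₀ a := by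
  -- Formal étaleness identifies E ⊗ Ω_A with Ω_E, so the linear form on Ω_A given by `D₀` extends
  -- by base change.
  let e := KaehlerDifferential.tensorKaehlerEquivOfFormallyEtale K A E
  let φ : Ω[E⁄K] →ₗ[E] E :=
    (D₀.liftKaehlerDifferential.liftBaseChange E) ∘ₗ e.symm.toLinearMap
  refine ⟨φ.compDer (KaehlerDifferential.D K E), fun a => ?_⟩
  have h2 : e.symm (KaehlerDifferential.D K E (algebraMap A E a)) =
      1 ⊗ₜ KaehlerDifferential.D K A a :=
    KaehlerDifferential.tensorKaehlerEquivOfFormallyEtale_symm_D_algebraMap ..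
  simp [φ, h2]

/-- In characteristic zero a field extension is formally étale over a subring over whose
fraction field it is algebraic. -/
theorem Algebra.FormallyEtale.of_isAlgebraic {A E : Type*} [CommRing A] [IsDomain A] [CharZero A]
    [Field E] [Algebra A E] [FaithfulSMul A E] [Algebra.IsAlgebraic A E] :
    Algebra.FormallyEtale A E := by
  let : Algebra (FractionRing A) E := FractionRing.liftAlgebra _ _
  have : IsScalarTower A (FractionRing A) E :=
    FractionRing.isScalarTower_liftAlgebra _ _
  have : Algebra.IsAlgebraic (FractionRing A) E :=
    (IsFractionRing.comap_isAlgebraic_iff (A := A)).mp inferInstance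
  have : CharZero (FractionRing A) := inferInstance
  have : Algebra.FormallyEtale (FractionRing A) E := Algebra.FormallyEtale.of_isSeparable _ _
  have : Algebra.FormallyEtale A (FractionRing A) :=
    Algebra.FormallyEtale.of_isLocalization (nonZeroDivisors _)
  exact Algebra.FormallyEtale.comp _ (FractionRing A) _

/-- In characteristic zero, algebraically independent elements of a field extension are
differentially independent: a derivation may be prescribed on them. -/
theorem AlgebraicIndependent.exists_derivation {K E ι : Type*} [Field K] [CharZero K] [Field E]
    [Algebra K E] {v : ι → E} (hv : AlgebraicIndependent K v) (c : ι → E) :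
    ∃ δ : Derivation K E E, ∀ i, δ (v i) = c i := by
  -- E is algebraic over the polynomial ring on a transcendence basis, hence formally étale over it,
  -- and on a polynomial ring a derivation is arbitrary on the variables.
  obtain ⟨t, hst, ht⟩ := exists_isTranscendenceBasis_superset hv.coe_range
  let : Algebra (MvPolynomial t K) E := (MvPolynomial.aeval (R := K) (fun x : t => (x : E))).toAlgebra
  have hmap : ∀ p, algebraMap (MvPolynomial t K) E p = MvPolynomial.aeval (fun x : t => (x : E)) p :=
    fun p => rfl
  have : IsScalarTower K (MvPolynomial t K) E :=
    IsScalarTower.of_algebraMap_eq fun r => by rw [hmap]; simp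
  have : FaithfulSMul (MvPolynomial t K) E :=
    (faithfulSMul_iff_algebraMap_injective _ _).mpr ht.1
  have : Algebra.IsAlgebraic (MvPolynomial t K) E := by
    have h1 := ht.isAlgebraic
    refine Algebra.IsAlgebraic.of_ringHom_of_comp_eq (S := Algebra.adjoin K (Set.range ((↑) : t → E)))
      ht.1.aevalEquiv (RingHom.id E) ht.1.aevalEquiv.surjective Function.injective_id ?_
    ext <;> simp [hmap]
  have : Algebra.FormallyEtale (MvPolynomial t K) E := .of_isAlgebraic
  classical
  -- Basis elements outside the family get the value 0; on the family the chosen index is the right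
  -- one because `v` is injective.
  obtain ⟨δ, hδ⟩ := Derivation.exists_extension_of_formallyEtale
    (MvPolynomial.mkDerivation K
      fun x : t => if h : ∃ i, v i = x then c h.choose else 0)
  refine ⟨δ, fun i => ?_⟩
  have hi : v i ∈ t := hst ⟨i, rfl⟩
  have h3 : ∃ j, v j = v i := ⟨i, rfl⟩
  have h4 : h3.choose = i := hv.injective h3.choose_spec
  have h1 := hδ (MvPolynomial.X ⟨v i, hi⟩)
  rw [hmap] at h1
  simpa [h4] using h1

/-- The chain rule for a derivation applied to the value of a polynomial. -/
theorem Derivation.map_mvPolynomial_aeval {K E σ : Type*} [Field K] [Field E] [Algebra K E]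
    [Fintype σ] (δ : Derivation K E E) (x : σ → E) (p : MvPolynomial σ K) :
    δ (MvPolynomial.aeval x p) =
      ∑ l, MvPolynomial.aeval x (MvPolynomial.pderiv l p) * δ (x l) := by
  classical
  induction p using MvPolynomial.induction_on with
  | C a => simp
  | add p q hp hq => simp [hp, hq, add_mul, Finset.sum_add_distrib]
  | mul_X p i hp =>
    simp only [map_mul, MvPolynomial.aeval_X, Derivation.leibniz, hp, smul_eq_mul,
      MvPolynomial.pderiv_X, map_add, Pi.single_apply, apply_ite (MvPolynomial.aeval x), map_one,
      map_zero, add_mul, Finset.sum_add_distrib, Finset.mul_sum]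
    congr 1
    · simp [mul_ite, ite_mul]
    · exact Finset.sum_congr rfl fun l _ => by ring

/-! ### Bertini's theorem on affine schemes -/

/-- A generic member of a linear system containing a constant section is not tangent to the
subvariety cut out by the polynomials `F`, at any point over the generic point of the parameter
space: the Lagrange multiplier equations have no solution. -/
theorem AlgebraicIndependent.not_tangent {K E σ κ ι : Type*} [Field K] [CharZero K] [Field E]
    [Algebra K E] [Fintype σ] [Fintype κ] [Fintype ι]
    (F : κ → MvPolynomial σ K) (u : ι → MvPolynomial σ K) {i₀ : ι} (hu : u i₀ = 1)
    (x : σ → E) (μ : κ → E) {c : ι → E} (hc : AlgebraicIndependent K c)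
    (hF : ∀ j, MvPolynomial.aeval x (F j) = 0)
    (hs : ∑ k, c k * MvPolynomial.aeval x (u k) = 0)
    (hd : ∀ l, ∑ k, c k * MvPolynomial.aeval x (MvPolynomial.pderiv l (u k)) =
      ∑ j, μ j * MvPolynomial.aeval x (MvPolynomial.pderiv l (F j))) : False := by
  classical
  -- Differentiate the equation of the member along the parameter `c i₀`. The explicit dependence
  -- contributes `u i₀ = 1`. The dependence through `x` is a combination of the derivatives of the
  -- relations F_j(x) = 0, hence zero.
  obtain ⟨δ, hδ⟩ := hc.exists_derivation (Pi.single i₀ 1)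
  have h1 := congrArg δ hs
  have h2 : ∀ j, ∑ l, MvPolynomial.aeval x (MvPolynomial.pderiv l (F j)) * δ (x l) = 0 := fun j => by
    rw [← Derivation.map_mvPolynomial_aeval, hF, map_zero]
  have h3 : ∑ k, c k * δ (MvPolynomial.aeval x (u k)) = 0 := by
    calc ∑ k, c k * δ (MvPolynomial.aeval x (u k))
        = ∑ l, (∑ k, c k * MvPolynomial.aeval x (MvPolynomial.pderiv l (u k))) * δ (x l) := by
          simp only [Derivation.map_mvPolynomial_aeval, Finset.mul_sum, Finset.sum_mul]
          rw [Finset.sum_comm]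
          simp only [mul_assoc]
      _ = ∑ j, μ j * ∑ l, MvPolynomial.aeval x (MvPolynomial.pderiv l (F j)) * δ (x l) := by
          simp only [hd, Finset.mul_sum, Finset.sum_mul]
          rw [Finset.sum_comm]
          simp only [mul_assoc]
      _ = 0 := by simp [h2]
  have h4 : ∑ k, MvPolynomial.aeval x (u k) * δ (c k) = 1 := by
    simp [hδ, Pi.single_apply, hu]
  simp only [map_sum, Derivation.leibniz, smul_eq_mul, Finset.sum_add_distrib, h3, h4, map_zero,
    zero_add, one_ne_zero] at h1

/-- An ideal of an algebra over a polynomial ring without field-valued points lying over the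
generic point of the parameter space contains a nonzero polynomial in the parameters. -/
theorem Ideal.exists_ne_zero_algebraMap_mem {A W : Type*} [CommRing A] [IsDomain A] [CommRing W]
    [Algebra A W] (J : Ideal W)
    (h : ∀ Q : Ideal W, Q.IsPrime → J ≤ Q → ¬ Function.Injective (algebraMap A (W ⧸ Q))) :
    ∃ p : A, p ≠ 0 ∧ algebraMap A W p ∈ J := by
  by_contra! hp
  -- If `J` misses the nonzero elements of `A`, so does some prime above `J`, and `A` embeds into
  -- its quotient.
  have hdis : Disjoint (J : Set W) ((nonZeroDivisors A).map (algebraMap A W) : Submonoid W) := by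
    rw [Set.disjoint_left]
    rintro w hw ⟨p, hp', rfl⟩
    exact hp p (nonZeroDivisors.ne_zero hp') hw
  obtain ⟨Q, hQ, hJQ, hd⟩ := Ideal.exists_le_prime_disjoint _ _ hdis
  refine h Q hQ hJQ ((injective_iff_map_eq_zero _).mpr fun a ha => ?_)
  by_contra h0
  rw [IsScalarTower.algebraMap_apply A W (W ⧸ Q), Ideal.Quotient.algebraMap_eq,
    Ideal.Quotient.eq_zero_iff_mem] at ha
  exact Set.disjoint_left.mp hd ha ⟨a, mem_nonZeroDivisors_of_ne_zero h0, rfl⟩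

/-- The parameters of the members of a linear system which are tangent somewhere to the subvariety
cut out by `F` satisfy a nontrivial polynomial relation. -/
theorem MvPolynomial.exists_discriminant.{w} {K σ κ ι : Type*} [Field K] [CharZero K]
    [Fintype σ] [Fintype κ] [Fintype ι]
    (F : κ → MvPolynomial σ K) (u : ι → MvPolynomial σ K) {i₀ : ι} (hu : u i₀ = 1) :
    ∃ p : MvPolynomial ι K, p ≠ 0 ∧ ∀ (k : Type w) [Field k] [Algebra K k] (x : σ → k) (μ : κ → k)
      (c : ι → k), (∀ j, aeval x (F j) = 0) → ∑ i, c i * aeval x (u i) = 0 →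
      (∀ l, ∑ i, c i * aeval x (pderiv l (u i)) = ∑ j, μ j * aeval x (pderiv l (F j))) →
      aeval c p = 0 := by
  -- The incidence variety: `σ` indexes the coordinates of a point, `κ` the Lagrange multipliers,
  -- `ι` the parameters of the member. The discriminant is obtained by eliminating the first two
  -- groups of variables.
  let ιx : MvPolynomial σ K →ₐ[K] MvPolynomial (σ ⊕ κ ⊕ ι) K := rename Sum.inl
  let μ' : κ → MvPolynomial (σ ⊕ κ ⊕ ι) K := fun j => X (Sum.inr (Sum.inl j))
  let c' : ι → MvPolynomial (σ ⊕ κ ⊕ ι) K := fun i => X (Sum.inr (Sum.inr i))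
  let : Algebra (MvPolynomial ι K) (MvPolynomial (σ ⊕ κ ⊕ ι) K) :=
    (rename (Sum.inr ∘ Sum.inr) : MvPolynomial ι K →ₐ[K] _).toAlgebra
  have hmap : ∀ p, algebraMap (MvPolynomial ι K) (MvPolynomial (σ ⊕ κ ⊕ ι) K) p =
    rename (Sum.inr ∘ Sum.inr) p := fun p => rfl
  let J : Ideal (MvPolynomial (σ ⊕ κ ⊕ ι) K) := Ideal.span
    (Set.range (fun j => ιx (F j)) ∪ {∑ i, c' i * ιx (u i)} ∪
      Set.range fun l => ∑ i, c' i * ιx (pderiv l (u i)) - ∑ j, μ' j * ιx (pderiv l (F j)))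
  have hF : ∀ j, ιx (F j) ∈ J := fun j => Ideal.subset_span (Or.inl (Or.inl ⟨j, rfl⟩))
  have hs : ∑ i, c' i * ιx (u i) ∈ J := Ideal.subset_span (Or.inl (Or.inr rfl))
  have hd : ∀ l, ∑ i, c' i * ιx (pderiv l (u i)) - ∑ j, μ' j * ιx (pderiv l (F j)) ∈ J :=
    fun l => Ideal.subset_span (Or.inr ⟨l, rfl⟩)
  obtain ⟨p, hp0, hp⟩ := J.exists_ne_zero_algebraMap_mem (A := MvPolynomial ι K)
    (fun Q hQ hJQ hinj => by
      let E := FractionRing (MvPolynomial (σ ⊕ κ ⊕ ι) K ⧸ Q)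
      let π : MvPolynomial (σ ⊕ κ ⊕ ι) K →ₐ[K] E :=
        (IsScalarTower.toAlgHom K (MvPolynomial (σ ⊕ κ ⊕ ι) K ⧸ Q) E).comp (Ideal.Quotient.mkₐ K Q)
      have hπ : ∀ w ∈ J, π w = 0 := fun w hw => by
        have : Ideal.Quotient.mk Q w = 0 := Ideal.Quotient.eq_zero_iff_mem.mpr (hJQ hw)
        simp [π, this]
      have hx : ∀ q, aeval (fun l => π (X (Sum.inl l))) q = π (ιx q) := fun q => by
        rw [← AlgHom.comp_apply]
        congr 1
        ext l
        simp [ιx]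
      have hc : AlgebraicIndependent K fun i => π (c' i) := by
        have : (aeval fun i => π (c' i) : MvPolynomial ι K →ₐ[K] E) =
            π.comp (rename (Sum.inr ∘ Sum.inr)) := by
          ext i
          simp [c']
        rw [AlgebraicIndependent, this]
        exact (IsFractionRing.injective (MvPolynomial (σ ⊕ κ ⊕ ι) K ⧸ Q) E).comp hinj
      refine hc.not_tangent F u hu (fun l => π (X (Sum.inl l))) (fun j => π (μ' j))
        (fun j => ?_) ?_ fun l => ?_
      · rw [hx, hπ _ (hF j)]
      · simpa only [hx, map_sum, map_mul] using hπ _ hs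
      · simpa only [hx, map_sub, map_sum, map_mul, sub_eq_zero] using hπ _ (hd l))
  refine ⟨p, hp0, fun k _ _ x μ c hkF hks hkd => ?_⟩
  let ψ : MvPolynomial (σ ⊕ κ ⊕ ι) K →ₐ[K] k := aeval (Sum.elim x (Sum.elim μ c))
  have hx : ∀ q, ψ (ιx q) = aeval x q := fun q => by
    simp only [ψ, ιx, aeval_rename, Sum.elim_comp_inl]
  have hJ : J ≤ RingHom.ker ψ := by
    rw [Ideal.span_le]
    rintro _ ((⟨j, rfl⟩ | rfl) | ⟨l, rfl⟩)
    · simpa only [SetLike.mem_coe, RingHom.mem_ker, hx] using hkF j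
    · simpa [hx, ψ, c'] using hks
    · simpa [hx, ψ, c', μ', sub_eq_zero] using hkd l
  have := hJ hp
  rw [RingHom.mem_ker, hmap] at this
  simpa only [ψ, aeval_rename, ← Function.comp_assoc, Sum.elim_comp_inr] using this

theorem Derivation.map_mem_of_mem_sq {R A : Type*} [CommRing R] [CommRing A] [Algebra R A]
    (δ : Derivation R A A) {𝔮 : Ideal A} {a : A} (ha : a ∈ 𝔮 ^ 2) : δ a ∈ 𝔮 := by
  rw [pow_two] at ha
  induction ha using Submodule.mul_induction_on' with
  | mem_mul_mem a ha b hb =>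
    rw [Derivation.leibniz]
    exact add_mem (Ideal.mul_mem_right _ _ ha) (Ideal.mul_mem_right _ _ hb)
  | add a _ b _ ha hb => rw [map_add]; exact add_mem ha hb

/-- **Bertini's theorem**, affine form in characteristic zero: for a linear system containing a
constant section, on the subvariety cut out by `I`, the members with general parameters have no
singular points. -/
theorem MvPolynomial.exists_bertini {K σ ι : Type*} [Field K] [CharZero K] [Finite σ] [Fintype ι]
    (I : Ideal (MvPolynomial σ K)) (u : ι → MvPolynomial σ K) {i₀ : ι} (hu : u i₀ = 1) :
    ∃ p : MvPolynomial ι K, p ≠ 0 ∧ ∀ c : ι → K, eval c p ≠ 0 →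
      ∀ 𝔮 : Ideal (MvPolynomial σ K), 𝔮.IsPrime → I ≤ 𝔮 → ∑ i, C (c i) * u i ∈ 𝔮 → ∀ b ∉ 𝔮,
        b * ∑ i, C (c i) * u i ∉ 𝔮 ^ 2 ⊔ I := by
  have := Fintype.ofFinite σ
  obtain ⟨s, rfl⟩ := (isNoetherianRing_iff_ideal_fg _).mp inferInstance I
  obtain ⟨p, hp0, hp⟩ := exists_discriminant (fun f : s => (f : MvPolynomial σ K)) u hu
  refine ⟨p, hp0, fun c hc 𝔮 h𝔮 hI hs b hb hbs => hc ?_⟩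
  -- The discriminant is tested at the tautological point of V(𝔮) with values in its residue field.
  let k := FractionRing (MvPolynomial σ K ⧸ 𝔮)
  let π : MvPolynomial σ K →ₐ[K] k :=
    (IsScalarTower.toAlgHom K (MvPolynomial σ K ⧸ 𝔮) k).comp (Ideal.Quotient.mkₐ K 𝔮)
  have hπ : ∀ q, π q = 0 ↔ q ∈ 𝔮 := fun q => by
    rw [← Ideal.Quotient.eq_zero_iff_mem]
    exact (IsFractionRing.injective (MvPolynomial σ K ⧸ 𝔮) k).eq_iff' (map_zero _)
  have hx : ∀ q, aeval (fun l => π (X l)) q = π q := fun q => by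
    rw [← MvPolynomial.comp_aeval_apply]; simp
  obtain ⟨a, ha, e, he, hae⟩ := Submodule.mem_sup.mp hbs
  obtain ⟨m, rfl⟩ := (Submodule.mem_span_finset'.mp he)
  have hsq : ∀ l, pderiv l a ∈ 𝔮 := fun l => (pderiv l).map_mem_of_mem_sq ha
  have hf : ∀ f : s, π f = 0 := fun f => (hπ _).mpr (hI (Submodule.subset_span f.2))
  -- Write s for the member. Differentiating b s = a + ∑ m_f f modulo 𝔮, where s, f and the
  -- derivatives of `a` ∈ 𝔮² vanish, gives b ∂s = ∑ m_f ∂f; this dictates the multipliers m_f / b.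
  have key := hp k (fun l => π (X l)) (fun f => π (m f) / π b) (fun i => algebraMap K k (c i))
    (fun f => by rw [hx]; exact hf f)
    (by
      have := (hπ _).mpr hs
      simpa [hx] using this)
    (fun l => by
      have h1 := congrArg (fun q => π (pderiv l q)) hae
      have h2 : π b ≠ 0 := fun h => hb ((hπ _).mp h)
      have h3 := (hπ _).mpr hs
      have h4 := (hπ _).mpr (hsq l)
      simp only [map_add, map_sum, Derivation.leibniz, smul_eq_mul, map_mul, h4, hf, zero_mul,
        add_zero, zero_add, pderiv_C, mul_zero] at h1
      simp only [map_sum, map_mul] at h3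
      have h5 : ∀ i, π (C (c i)) = algebraMap K k (c i) := fun i => π.commutes (c i)
      rw [h3, zero_mul, add_zero] at h1
      simp only [h5] at h1
      simp only [hx, div_mul_eq_mul_div, ← Finset.sum_div, h1]
      rw [mul_div_cancel_left₀ _ h2])
  have : aeval (fun i => algebraMap K k (c i)) p = algebraMap K k (eval c p) := by
    rw [← MvPolynomial.coe_aeval_eq_eval]
    exact aeval_algebraMap_apply k c p
  exact (algebraMap K k).injective (by rw [← this, key, map_zero])

/-- **Bertini's theorem** for a linear system containing a constant section on an affine scheme of
finite type over a field of characteristic zero: the members with general parameters have no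
singular points on the closed subscheme defined by `I`. -/
theorem Algebra.FiniteType.exists_bertini {K B ι : Type*} [Field K] [CharZero K] [CommRing B]
    [Algebra K B] [Algebra.FiniteType K B] [Fintype ι] (I : Ideal B) (u : ι → B) {i₀ : ι}
    (hu : u i₀ = 1) :
    ∃ p : MvPolynomial ι K, p ≠ 0 ∧ ∀ c : ι → K, MvPolynomial.eval c p ≠ 0 →
      ∀ q : Ideal B, q.IsPrime → I ≤ q → ∑ i, c i • u i ∈ q → ∀ b ∉ q,
        b * ∑ i, c i • u i ∉ q ^ 2 ⊔ I := by
  classical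
  obtain ⟨n, φ, hφ⟩ := Algebra.FiniteType.iff_quotient_mvPolynomial''.mp ‹_›
  choose u' hu' using fun i => hφ (u i)
  -- The chosen lift of `u i₀ = 1` need not be 1, so it is replaced by 1.
  obtain ⟨p, hp0, hp⟩ := MvPolynomial.exists_bertini (I.comap φ) (Function.update u' i₀ 1)
    (Function.update_self i₀ 1 u')
  refine ⟨p, hp0, fun c hc q hq hI hs b hb hbs => ?_⟩
  have hu'' : ∀ i, φ (Function.update u' i₀ 1 i) = u i := fun i => by
    by_cases h : i = i₀
    · subst h; simp [hu]
    · simp [h, hu']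
  have hsum : φ (∑ i, MvPolynomial.C (c i) * Function.update u' i₀ 1 i) = ∑ i, c i • u i := by
    rw [map_sum]
    exact Finset.sum_congr rfl fun i _ => by
      rw [map_mul, hu'', Algebra.smul_def]; congr 1; exact φ.commutes (c i)
  obtain ⟨b', rfl⟩ := hφ b
  have hmap : ((q.comap φ) ^ 2 ⊔ I.comap φ).map φ = q ^ 2 ⊔ I := by
    rw [Ideal.map_sup, Ideal.map_pow, Ideal.map_comap_of_surjective _ hφ,
      Ideal.map_comap_of_surjective _ hφ]
  refine hp c hc (q.comap φ) inferInstance (Ideal.comap_mono hI) ?_ b' hb ?_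
  · rw [Ideal.mem_comap, hsum]; exact hs
  · rw [← hsum, ← map_mul, ← hmap, ← Ideal.mem_comap, Ideal.comap_map_of_surjective _ hφ] at hbs
    -- The kernel of `φ`, which arises on pulling back, is already contained in `I.comap φ`.
    refine (sup_le le_rfl ?_ : _ ≤ (q.comap φ) ^ 2 ⊔ I.comap φ) hbs
    exact le_sup_of_le_right (Ideal.comap_mono bot_le)

/-! ### Regular systems of parameters -/

open IsLocalRing in
/-- Exchange for regular systems of parameters: an element of the maximal ideal which is
independent of the members of a system of generators with indices in `C`, modulo the square of the
maximal ideal, may replace one of the other members. -/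
theorem IsLocalRing.exists_span_update_eq_maximalIdeal {R ι : Type*} [CommRing R] [IsLocalRing R]
    [Fintype ι] [DecidableEq ι] {t : ι → R} (ht : Ideal.span (Set.range t) = maximalIdeal R)
    {C : Set ι} {s : R} (hs : s ∈ maximalIdeal R)
    (hsC : s ∉ maximalIdeal R ^ 2 ⊔ Ideal.span (t '' C)) :
    ∃ i ∉ C, Ideal.span (Set.range (Function.update t i s)) = maximalIdeal R := by
  have htm : ∀ j, t j ∈ maximalIdeal R := fun j => ht ▸ Ideal.subset_span ⟨j, rfl⟩
  obtain ⟨a, ha⟩ := (Ideal.mem_span_range_iff_exists_fun).mp (ht ▸ hs)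
  obtain ⟨i, hiC, hi⟩ : ∃ i ∉ C, IsUnit (a i) := by
    by_contra! h
    refine hsC (ha ▸ Ideal.sum_mem _ fun j _ => ?_)
    by_cases hj : j ∈ C
    · exact Ideal.mul_mem_left _ _ (Ideal.mem_sup_right (Ideal.subset_span ⟨j, hj, rfl⟩))
    · rw [pow_two]
      exact Ideal.mem_sup_left (Ideal.mul_mem_mul ((mem_maximalIdeal _).mpr (h j hj)) (htm j))
  refine ⟨i, hiC, le_antisymm (Ideal.span_le.mpr ?_) (ht ▸ Ideal.span_le.mpr ?_)⟩
  · rintro _ ⟨j, rfl⟩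
    by_cases hj : j = i
    · subst hj; simpa using hs
    · simpa [hj] using htm j
  · have hother : ∀ j, j ≠ i → t j ∈ Ideal.span (Set.range (Function.update t i s)) :=
      fun j hj => Ideal.subset_span ⟨j, by simp [hj]⟩
    rintro _ ⟨j, rfl⟩
    by_cases hj : j = i
    · subst hj
      obtain ⟨b, hb⟩ := hi.exists_left_inv
      have h1 : t j = b * (s - ∑ l ∈ Finset.univ.erase j, a l * t l) := by
        rw [← ha, ← Finset.add_sum_erase _ _ (Finset.mem_univ j), add_sub_cancel_right, ← mul_assoc,
          hb, one_mul]
      rw [h1]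
      refine Ideal.mul_mem_left _ _ (sub_mem (Ideal.subset_span ⟨j, by simp⟩)
        (Ideal.sum_mem _ fun l hl => Ideal.mul_mem_left _ _ (hother l (Finset.ne_of_mem_erase hl))))
    · exact hother j hj

open IsLocalRing in
theorem IsLocalRing.ringKrullDim_le_of_span_range_eq {R : Type*} [CommRing R] [IsLocalRing R]
    [IsNoetherianRing R] {d : ℕ} {t : Fin d → R}
    (ht : Ideal.span (Set.range t) = maximalIdeal R) : ringKrullDim R ≤ d := by
  refine (ringKrullDim_le_spanFinrank_maximalIdeal R).trans (Nat.cast_le.mpr ?_)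
  rw [← ht]
  refine (Submodule.spanFinrank_span_le_ncard_of_finite (Set.finite_range t)).trans ?_
  rw [← Set.image_univ]
  exact (Set.ncard_image_le).trans (by simp [Set.ncard_univ])

open IsLocalRing in
/-- The quotient of a regular local ring by a member of a regular system of parameters is a
regular local ring. -/
theorem IsLocalRing.ringKrullDim_quotient_of_span_range_eq {R : Type*} [CommRing R] [IsLocalRing R]
    [IsNoetherianRing R] {d : ℕ} (hd : ringKrullDim R = (d + 1 : ℕ)) {t : Fin (d + 1) → R}
    (ht : Ideal.span (Set.range t) = maximalIdeal R) (i : Fin (d + 1))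
    [IsLocalRing (R ⧸ Ideal.span {t i})] :
    ringKrullDim (R ⧸ Ideal.span {t i}) = d ∧
      Ideal.span (Set.range fun j => Ideal.Quotient.mk (Ideal.span {t i}) (t (i.succAbove j))) =
        maximalIdeal (R ⧸ Ideal.span {t i}) := by
  have hti : t i ∈ maximalIdeal R := ht ▸ Ideal.subset_span ⟨i, rfl⟩
  have hspan : Ideal.span (Set.range fun j => Ideal.Quotient.mk (Ideal.span {t i})
      (t (i.succAbove j))) = maximalIdeal (R ⧸ Ideal.span {t i}) := by
    have h1 : (maximalIdeal R).map (Ideal.Quotient.mk (Ideal.span {t i})) =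
        maximalIdeal (R ⧸ Ideal.span {t i}) :=
      map_maximalIdeal_of_surjective _ Ideal.Quotient.mk_surjective
    rw [← h1, ← ht, Ideal.map_span]
    refine le_antisymm (Ideal.span_mono ?_) (Ideal.span_le.mpr ?_)
    · rintro _ ⟨j, rfl⟩; exact ⟨_, ⟨_, rfl⟩, rfl⟩
    · rintro _ ⟨_, ⟨j, rfl⟩, rfl⟩
      rcases Fin.eq_self_or_eq_succAbove i j with rfl | ⟨k, rfl⟩
      · simp [Ideal.Quotient.eq_zero_iff_mem.mpr (Ideal.mem_span_singleton_self (t j))]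
      · exact Ideal.subset_span ⟨k, rfl⟩
  refine ⟨le_antisymm (ringKrullDim_le_of_span_range_eq hspan) ?_, hspan⟩
  -- Dividing by one element of the maximal ideal lowers the dimension by at most one.
  have h2 := ringKrullDim_le_ringKrullDim_quotSMulTop_succ hti
  rw [hd, ← Submodule.ideal_span_singleton_smul, smul_eq_mul, Ideal.mul_top] at h2
  push_cast at h2
  exact (ENat.WithBot.add_le_add_one_right_iff).mp h2

open IsLocalRing in
/-- A regular local ring is a domain. -/
theorem IsLocalRing.isDomain_of_span_range_eq {d : ℕ} : ∀ {R : Type*} [CommRing R] [IsLocalRing R]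
    [IsNoetherianRing R] (_ : ringKrullDim R = d) {t : Fin d → R}
    (_ : Ideal.span (Set.range t) = maximalIdeal R), IsDomain R := by
  induction d with
  | zero =>
    intro R _ _ _ hd t ht
    have : maximalIdeal R = ⊥ := by rw [← ht]; simp
    exact (isField_iff_maximalIdeal_eq.mpr this).isDomain
  | succ d ih =>
    intro R _ _ _ hd t ht
    have hm : ∀ p ∈ minimalPrimes R, ¬ maximalIdeal R ≤ p := fun p hp hle => by
      have hmp : maximalIdeal R = p := le_antisymm hle (le_maximalIdeal hp.1.1.ne_top)
      have h1 := maximalIdeal_height_eq_ringKrullDim (R := R)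
      have : p.IsPrime := hp.1.1
      rw [hd, hmp, Ideal.height_eq_zero_iff.mpr hp] at h1
      norm_cast at h1
    have hsq : ¬ maximalIdeal R ≤ maximalIdeal R ^ 2 := fun hle => by
      have h1 := (maximalIdeal_sq_lt_maximalIdeal R).mpr (fun h => by
        rw [ringKrullDim_eq_zero_of_isField h] at hd
        norm_cast at hd)
      exact h1.not_ge hle
    -- Prime avoidance, which tolerates the ideal 𝔪², not assumed prime. Such an `s` belongs to a
    -- regular system of parameters, so R/(s) is a domain by induction.
    obtain ⟨s, hsm, hs2, hsp⟩ : ∃ s ∈ maximalIdeal R, s ∉ maximalIdeal R ^ 2 ∧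
        ∀ p ∈ minimalPrimes R, s ∉ p := by
      by_contra! h
      classical
      have hfin := minimalPrimes.finite_of_isNoetherianRing R
      have := (Ideal.subset_union_prime (s := insert (maximalIdeal R ^ 2) hfin.toFinset)
        (f := id) (maximalIdeal R ^ 2) (maximalIdeal R ^ 2)
        (fun p hp h1 _ => by
          have := (Finset.mem_insert.mp hp).resolve_left h1
          exact (hfin.mem_toFinset.mp this).1.1) (I := maximalIdeal R)).mp (fun s hs => by
            by_cases h2 : s ∈ maximalIdeal R ^ 2
            · simp [h2]
            · obtain ⟨p, hp, hsp⟩ := h s hs h2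
              simp only [Set.mem_iUnion]
              exact ⟨p, by simp [hp], hsp⟩)
      obtain ⟨p, hp, hle⟩ := this
      rcases Finset.mem_insert.mp hp with rfl | hp
      · exact hsq hle
      · exact hm p (hfin.mem_toFinset.mp hp) hle
    obtain ⟨i, -, hi⟩ := exists_span_update_eq_maximalIdeal ht (C := ∅) hsm (by simpa using hs2)
    have hne : Ideal.span {Function.update t i s i} ≠ ⊤ := fun h => by
      have := (Ideal.span_singleton_le_iff_mem (maximalIdeal R)).mpr hsm
      simp only [Function.update_self] at h
      exact Ideal.IsPrime.ne_top' (top_le_iff.mp (h ▸ this))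
    have : Nontrivial (R ⧸ Ideal.span {Function.update t i s i}) :=
      Ideal.Quotient.nontrivial_iff.mpr hne
    have : IsLocalRing (R ⧸ Ideal.span {Function.update t i s i}) :=
      .of_surjective' _ Ideal.Quotient.mk_surjective
    obtain ⟨h1, h2⟩ := ringKrullDim_quotient_of_span_range_eq hd hi i
    have hdom := ih h1 h2
    rw [Function.update_self] at hdom
    have hprime : (Ideal.span {s}).IsPrime := Ideal.Quotient.isDomain_iff_prime _ |>.mp hdom
    -- A minimal prime p inside (s) does not contain s, so p = s p and p = 0 by Nakayama.
    obtain ⟨p, hp, hps⟩ := Ideal.exists_minimalPrimes_le (bot_le : ⊥ ≤ Ideal.span {s})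
    have hpbot : p = ⊥ := by
      refine Submodule.eq_bot_of_le_smul_of_le_jacobson_bot (maximalIdeal R) p
        (IsNoetherian.noetherian p) (fun a ha => ?_) (by rw [jacobson_eq_maximalIdeal _ bot_ne_top])
      obtain ⟨b, rfl⟩ := Ideal.mem_span_singleton'.mp (hps ha)
      have hb : b ∈ p := (hp.1.1.mem_or_mem ha).resolve_right (hsp p hp)
      rw [mul_comm]
      exact Submodule.smul_mem_smul hsm hb
    have : (⊥ : Ideal R).IsPrime := hpbot ▸ hp.1.1
    exact IsDomain.of_bot_isPrime R

open IsLocalRing in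
/-- A member of a regular system of parameters generates a prime ideal. -/
theorem IsLocalRing.isPrime_span_singleton_of_span_range_eq {R : Type*} [CommRing R] [IsLocalRing R]
    [IsNoetherianRing R] {d : ℕ} (hd : ringKrullDim R = d) {t : Fin d → R}
    (ht : Ideal.span (Set.range t) = maximalIdeal R) (i : Fin d) :
    (Ideal.span {t i}).IsPrime := by
  obtain _ | d := d
  · exact i.elim0
  have hti : t i ∈ maximalIdeal R := ht ▸ Ideal.subset_span ⟨i, rfl⟩
  have hne : Ideal.span {t i} ≠ ⊤ := fun h =>
    Ideal.IsPrime.ne_top' (top_le_iff.mp (h ▸ (Ideal.span_singleton_le_iff_mem _).mpr hti))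
  have : Nontrivial (R ⧸ Ideal.span {t i}) := Ideal.Quotient.nontrivial_iff.mpr hne
  have : IsLocalRing (R ⧸ Ideal.span {t i}) := .of_surjective' _ Ideal.Quotient.mk_surjective
  obtain ⟨h1, h2⟩ := ringKrullDim_quotient_of_span_range_eq hd ht i
  exact Ideal.Quotient.isDomain_iff_prime _ |>.mp (isDomain_of_span_range_eq h1 h2)

/-! ### Local rings of schemes embedded in Proj -/

section

variable {A σ : Type u} [CommRing A] [SetLike σ A] [AddSubgroupClass σ A]
  (𝒜 : ℕ → σ) [GradedRing 𝒜]

/-- Both sides are germs of the single section a/b on the basic open set of b. -/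
theorem AlgebraicGeometry.Proj.stalkSpecializes_stalkIso'_symm {P Q : ProjectiveSpectrum.top 𝒜}
    (h : P ⤳ Q) {m : ℕ} (a b : 𝒜 m) (hQ : (b : A) ∉ Q.asHomogeneousIdeal.toIdeal)
    (hP : (b : A) ∉ P.asHomogeneousIdeal.toIdeal) :
    (ProjectiveSpectrum.Proj.structureSheaf 𝒜).presheaf.stalkSpecializes h
      ((Proj.stalkIso' 𝒜 Q).symm (HomogeneousLocalization.mk ⟨m, a, b, hQ⟩)) =
    (Proj.stalkIso' 𝒜 P).symm (HomogeneousLocalization.mk ⟨m, a, b, hP⟩) := by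
  rw [Proj.stalkIso'_symm_mk, Proj.stalkIso'_symm_mk]
  exact TopCat.Presheaf.germ_stalkSpecializes_apply _ _ _ _

variable {𝒜} {X : Scheme.{u}} (i : X ⟶ Proj 𝒜)

/-- The image of a point under a morphism to `Proj`, as a homogeneous prime ideal. -/
def AlgebraicGeometry.Proj.imagePoint (x : X) : ProjectiveSpectrum 𝒜 := i x

/-- The ring of homogeneous fractions at the image of a point `x` under a morphism to `Proj` maps
to the local ring at `x`. -/
def AlgebraicGeometry.Proj.fractionToStalk (x : X) :
    HomogeneousLocalization.AtPrime 𝒜 (Proj.imagePoint i x).asHomogeneousIdeal.toIdeal →+*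
      X.presheaf.stalk x :=
  (i.stalkMap x).hom.comp (Proj.stalkIso' 𝒜 (Proj.imagePoint i x)).symm.toRingHom

instance AlgebraicGeometry.Proj.isLocalHom_fractionToStalk (x : X) :
    IsLocalHom (Proj.fractionToStalk i x) := by
  have h : IsLocalHom (Proj.stalkIso' 𝒜 (Proj.imagePoint i x)).symm.toRingHom :=
    ⟨fun a ha => by
      have := ha.map (Proj.stalkIso' 𝒜 (Proj.imagePoint i x))
      simpa using this⟩
  exact ⟨fun a ha => h.map_nonunit a ((isUnit_map_iff (i.stalkMap x).hom _).mp ha)⟩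

theorem AlgebraicGeometry.Proj.fractionToStalk_surjective [IsClosedImmersion i] (x : X) :
    Function.Surjective (Proj.fractionToStalk i x) :=
  (i.stalkMap_surjective x).comp (Proj.stalkIso' 𝒜 (Proj.imagePoint i x)).symm.surjective

theorem AlgebraicGeometry.Proj.algebraMap_fractionToStalk [IsIntegral X] (x : X) {m : ℕ} (a b : 𝒜 m)
    (hx : (b : A) ∉ (Proj.imagePoint i x).asHomogeneousIdeal.toIdeal)
    (hη : (b : A) ∉ (Proj.imagePoint i (genericPoint X)).asHomogeneousIdeal.toIdeal) :
    algebraMap _ X.functionField (Proj.fractionToStalk i x (HomogeneousLocalization.mk ⟨m, a, b, hx⟩)) =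
      Proj.fractionToStalk i (genericPoint X) (HomogeneousLocalization.mk ⟨m, a, b, hη⟩) := by
  have h : genericPoint X ⤳ x := (genericPoint_spec X).specializes trivial
  have h1 := Scheme.Hom.stalkSpecializes_stalkMap_apply i _ _ h
    ((Proj.stalkIso' 𝒜 (Proj.imagePoint i x)).symm (HomogeneousLocalization.mk ⟨m, a, b, hx⟩))
  have h2 := Proj.stalkSpecializes_stalkIso'_symm 𝒜 (i.base.hom.map_specializes h) a b hx hη
  exact h1.symm.trans (congrArg (i.stalkMap (genericPoint X)) h2)

theorem AlgebraicGeometry.Proj.specializes_iff_le [IsClosedImmersion i] {z x : X} :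
    z ⤳ x ↔ (Proj.imagePoint i z).asHomogeneousIdeal ≤ (Proj.imagePoint i x).asHomogeneousIdeal := by
  rw [← i.isClosedEmbedding.isInducing.specializes_iff, specializes_iff_mem_closure]
  exact (ProjectiveSpectrum.le_iff_mem_closure 𝒜 (Proj.imagePoint i z) (Proj.imagePoint i x)).symm
end

/-! ### Homogeneous coordinates -/

theorem MvPolynomial.IsHomogeneous.eval₂_mul_pow {R S σ : Type*} [CommSemiring R] [CommSemiring S]
    [Fintype σ] {p : MvPolynomial σ R} {m : ℕ} (hp : p.IsHomogeneous m) (f : R →+* S) (g : σ → S)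
    (t : S) : p.eval₂ f g * t ^ m = p.eval₂ f fun j => g j * t := by
  rw [eval₂_eq', eval₂_eq', Finset.sum_mul]
  refine Finset.sum_congr rfl fun d hd => ?_
  have h1 : ∑ j, d j = m := by
    have := hp (mem_support_iff.mp hd)
    rwa [show (1 : σ → ℕ) = fun _ => 1 from rfl, ← Finsupp.degree_eq_weight_one,
      Finsupp.degree_eq_sum] at this
  simp only [mul_pow, Finset.prod_mul_distrib, Finset.prod_pow_eq_pow_sum, h1, mul_assoc]

/-- Homogeneous coordinates on an integral scheme `X` over `K`, given by rational functions
`coord`: the local ring at each point consists of the quotients of forms of equal degree whose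
denominator is not in a prime ideal `ideal x`, the ideal of forms vanishing at `x`. -/
structure HomogeneousCoordinates (K : Type u) [Field K] (X : Scheme.{u}) [IsIntegral X]
    [Algebra K X.functionField] (N : ℕ) where
  coord : Fin (N + 1) → X.functionField
  ideal : X → Ideal (MvPolynomial (Fin (N + 1)) K)
  isPrime (x : X) : (ideal x).IsPrime
  exists_X_notMem (x : X) : ∃ k, MvPolynomial.X k ∉ ideal x
  specializes_iff {z x : X} : z ⤳ x ↔ ideal z ≤ ideal x
  isHomogeneous (x : X) {p} (hp : p ∈ ideal x) (m : ℕ) : p.homogeneousComponent m ∈ ideal x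
  aeval_ne_zero {x : X} {m : ℕ} {q : MvPolynomial (Fin (N + 1)) K} (hq : q.IsHomogeneous m)
    (hx : q ∉ ideal x) : MvPolynomial.aeval coord q ≠ 0
  exists_algebraMap_eq {x : X} {m : ℕ} {p q : MvPolynomial (Fin (N + 1)) K}
    (hp : p.IsHomogeneous m) (hq : q.IsHomogeneous m) (hx : q ∉ ideal x) :
    ∃ a : X.presheaf.stalk x, algebraMap _ X.functionField a =
      MvPolynomial.aeval coord p / MvPolynomial.aeval coord q ∧ (IsUnit a ↔ p ∉ ideal x)
  exists_eq_div {x : X} (a : X.presheaf.stalk x) : ∃ (m : ℕ) (p q : MvPolynomial (Fin (N + 1)) K),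
    p.IsHomogeneous m ∧ q.IsHomogeneous m ∧ q ∉ ideal x ∧ algebraMap _ X.functionField a =
      MvPolynomial.aeval coord p / MvPolynomial.aeval coord q

section
attribute [local instance] MvPolynomial.gradedAlgebra
open HomogeneousLocalization

theorem projectiveSpace_iSup_basicOpen (K : Type u) [Field K] (N : ℕ) :
    ⨆ k, Proj.basicOpen (MvPolynomial.homogeneousSubmodule (Fin (N + 1)) K) (MvPolynomial.X k) =
      ⊤ := by
  let 𝒜 := MvPolynomial.homogeneousSubmodule (Fin (N + 1)) K
  rw [Proj.iSup_basicOpen_eq_top' 𝒜 (MvPolynomial.X : Fin (N + 1) → _)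
    (fun k => ⟨1, MvPolynomial.isHomogeneous_X K k⟩)]
  refine top_le_iff.mp fun p _ => ?_
  have hp : p ∈ Algebra.adjoin K (Set.range (MvPolynomial.X : Fin (N + 1) → _)) := by
    rw [MvPolynomial.adjoin_range_X]; trivial
  induction hp using Algebra.adjoin_induction with
  | mem p hp => exact Algebra.subset_adjoin hp
  | algebraMap r => exact (Algebra.adjoin (𝒜 0) _).algebraMap_mem (algebraMap K (𝒜 0) r)
  | add p q _ _ hp hq => exact add_mem (hp trivial) (hq trivial)
  | mul p q _ _ hp hq => exact mul_mem (hp trivial) (hq trivial)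

instance (K : Type u) [Field K] (N : ℕ) : CompactSpace (projectiveSpace K N) := by
  let 𝒜 := MvPolynomial.homogeneousSubmodule (Fin (N + 1)) K
  have hX : ∀ k : Fin (N + 1), MvPolynomial.X k ∈ 𝒜 1 := MvPolynomial.isHomogeneous_X K
  have H (k : Fin (N + 1)) : IsCompact (Proj.basicOpen 𝒜 (MvPolynomial.X k)).1 := by
    rw [← Proj.opensRange_awayι 𝒜 _ (hX k) one_pos]
    exact isCompact_range (Proj.awayι 𝒜 _ (hX k) one_pos).continuous
  have h := congrArg (fun U : (Proj 𝒜).Opens => U.1) (projectiveSpace_iSup_basicOpen K N)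
  simp only [TopologicalSpace.Opens.iSup_mk, TopologicalSpace.Opens.carrier_eq_coe,
    TopologicalSpace.Opens.coe_mk, TopologicalSpace.Opens.coe_top] at h
  change CompactSpace (Proj 𝒜)
  rw [← isCompact_univ_iff, ← h]
  exact isCompact_iUnion H

/-- A scheme embedded in projective space has homogeneous coordinates. -/
theorem AlgebraicGeometry.IsClosedImmersion.exists_homogeneousCoordinates {K : Type u} [Field K]
    {N : ℕ} {X : Scheme.{u}} [IsIntegral X] (i : X ⟶ projectiveSpace K N) [IsClosedImmersion i] :
    ∃ _ : Algebra K X.functionField, Nonempty (HomogeneousCoordinates K X N) := by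
  let 𝒜 := MvPolynomial.homogeneousSubmodule (Fin (N + 1)) K
  let i' : X ⟶ Proj 𝒜 := i
  have : IsClosedImmersion i' := ‹IsClosedImmersion i›
  let P : X → Ideal (MvPolynomial (Fin (N + 1)) K) :=
    fun x => (Proj.imagePoint i' x).asHomogeneousIdeal.toIdeal
  have hprime : ∀ x, (P x).IsPrime := fun x => (Proj.imagePoint i' x).isPrime
  have hcover : ∀ x, ∃ k, MvPolynomial.X k ∉ P x := fun x => by
    have h : Proj.imagePoint i' x ∈ ⨆ k, Proj.basicOpen 𝒜 (MvPolynomial.X k) := by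
      rw [projectiveSpace_iSup_basicOpen]
      trivial
    obtain ⟨k, hk⟩ := TopologicalSpace.Opens.mem_iSup.mp h
    exact ⟨k, hk⟩
  have hη : ∀ x, P (genericPoint X) ≤ P x := fun x =>
    (Proj.specializes_iff_le i').mp ((genericPoint_spec X).specializes trivial)
  obtain ⟨k, hk⟩ := hcover (genericPoint X)
  let frac : ∀ (x : X) (m : ℕ) (p q : MvPolynomial (Fin (N + 1)) K) (hp : p.IsHomogeneous m)
    (hq : q.IsHomogeneous m) (hx : q ∉ P x), AtPrime 𝒜 (P x) := fun x m p q hp hq hx =>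
      HomogeneousLocalization.mk ⟨m, ⟨p, hp⟩, ⟨q, hq⟩, hx⟩
  have hfv : ∀ x m p q hp hq hx, (frac x m p q hp hq hx).val * algebraMap _ _ q =
      algebraMap _ (Localization (P x).primeCompl) p := fun x m p q hp hq hx => by
    change Localization.mk p (⟨q, hx⟩ : (P x).primeCompl) * _ = _
    rw [Localization.mk_eq_mk']
    exact IsLocalization.mk'_spec _ p (⟨q, hx⟩ : (P x).primeCompl)
  let γ : AtPrime 𝒜 (P (genericPoint X)) →+* X.functionField :=
    Proj.fractionToStalk i' (genericPoint X)
  let φ : K →+* AtPrime 𝒜 (P (genericPoint X)) :=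
    (fromZeroRingHom 𝒜 _).comp (algebraMap K (𝒜 0))
  -- The coordinates are normalised as X_j / X_k for a variable X_k that does not vanish at the
  -- generic point.
  let y' : Fin (N + 1) → AtPrime 𝒜 (P (genericPoint X)) := fun j =>
    frac _ 1 (MvPolynomial.X j) (MvPolynomial.X k) (MvPolynomial.isHomogeneous_X _ _)
      (MvPolynomial.isHomogeneous_X _ _) hk
  let : Algebra K X.functionField := (γ.comp φ).toAlgebra
  let y : Fin (N + 1) → X.functionField := fun j => γ (y' j)
  have hy : ∀ p, MvPolynomial.aeval y p = γ (p.eval₂ φ y') := fun p => by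
    rw [MvPolynomial.hom_eval₂]; rfl
  -- A form p of degree m takes the value p / X_k^m at the normalised coordinates; the factor X_k^m
  -- cancels in quotients of forms of equal degree.
  have hval : ∀ {m : ℕ} {p : MvPolynomial (Fin (N + 1)) K}, p.IsHomogeneous m →
      (p.eval₂ φ y').val * algebraMap _ _ (MvPolynomial.X k ^ m) =
        algebraMap _ (Localization (P (genericPoint X)).primeCompl) p := fun {m p} hp => by
    let g := algebraMap (AtPrime 𝒜 (P (genericPoint X)))
      (Localization (P (genericPoint X)).primeCompl)
    have h1 : (p.eval₂ φ y').val = p.eval₂ (g.comp φ) (g ∘ y') :=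
      MvPolynomial.hom_eval₂ p φ g y'
    have h2 : (g.comp φ) = (algebraMap _ (Localization (P (genericPoint X)).primeCompl)).comp
        (MvPolynomial.C (σ := Fin (N + 1)) (R := K)) := by
      ext a
      exact Localization.mk_one_eq_algebraMap _
    have h3 : (fun j => (g ∘ y') j * algebraMap _
        (Localization (P (genericPoint X)).primeCompl) (MvPolynomial.X k : MvPolynomial _ K)) =
        algebraMap _ (Localization (P (genericPoint X)).primeCompl) ∘
          (MvPolynomial.X : Fin (N + 1) → MvPolynomial (Fin (N + 1)) K) := by
      ext j
      exact hfv _ 1 (MvPolynomial.X j) (MvPolynomial.X k) (MvPolynomial.isHomogeneous_X _ _)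
        (MvPolynomial.isHomogeneous_X _ _) hk
    rw [h1, map_pow, hp.eval₂_mul_pow, h2, h3]
    refine (MvPolynomial.hom_eval₂ p MvPolynomial.C (algebraMap _
      (Localization (P (genericPoint X)).primeCompl)) MvPolynomial.X).symm.trans ?_
    rw [MvPolynomial.eval₂_eta]
  have hfrac : ∀ {m : ℕ} {p q : MvPolynomial (Fin (N + 1)) K} (hp : p.IsHomogeneous m)
      (hq : q.IsHomogeneous m) (hx : q ∉ P (genericPoint X)),
      MvPolynomial.aeval y q ≠ 0 ∧ γ (frac _ m p q hp hq hx) =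
        MvPolynomial.aeval y p / MvPolynomial.aeval y q := fun {m p q} hp hq hx => by
    have h1 : frac _ m p q hp hq hx * q.eval₂ φ y' = p.eval₂ φ y' := by
      apply HomogeneousLocalization.val_injective
      have hu : IsUnit (algebraMap _ (Localization (P (genericPoint X)).primeCompl)
          (MvPolynomial.X k ^ m : MvPolynomial (Fin (N + 1)) K)) :=
        IsLocalization.map_units _ (⟨_, hk⟩ ^ m : (P (genericPoint X)).primeCompl)
      rw [← hu.mul_left_inj, hval hp, HomogeneousLocalization.val_mul, mul_assoc, hval hq]
      exact hfv _ m p q hp hq hx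
    have h2 : IsUnit (q.eval₂ φ y') := by
      rw [← HomogeneousLocalization.isUnit_iff_isUnit_val]
      refine isUnit_of_mul_isUnit_left (y := algebraMap _ _ (MvPolynomial.X k ^ m : MvPolynomial (Fin (N + 1)) K)) ?_
      rw [hval hq]
      exact IsLocalization.map_units _ (⟨_, hx⟩ : (P (genericPoint X)).primeCompl)
    have h3 : MvPolynomial.aeval y q ≠ 0 := by
      rw [hy]; exact (h2.map γ).ne_zero
    exact ⟨h3, by rw [eq_div_iff h3, hy, hy, ← map_mul, h1]⟩
  refine ⟨inferInstance, ⟨?_⟩⟩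
  exact
  { coord := y
    ideal := P
    isPrime := hprime
    exists_X_notMem := hcover
    specializes_iff := Proj.specializes_iff_le i'
    isHomogeneous := fun x p hp m => by
      have h := (Proj.imagePoint i' x).asHomogeneousIdeal.isHomogeneous m hp
      rwa [← MvPolynomial.decomposition.decompose'_apply]
    aeval_ne_zero := fun {x m q} hq hx => (hfrac hq hq (fun h => hx (hη x h))).1
    exists_algebraMap_eq := fun {x m p q} hp hq hx => by
      have hx' : q ∉ P (genericPoint X) := fun h => hx (hη x h)
      refine ⟨Proj.fractionToStalk i' x (frac x m p q hp hq hx), ?_, ?_⟩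
      · rw [← (hfrac hp hq hx').2]
        exact Proj.algebraMap_fractionToStalk i' x ⟨p, hp⟩ ⟨q, hq⟩ hx hx'
      · rw [isUnit_map_iff, ← HomogeneousLocalization.isUnit_iff_isUnit_val]
        change IsUnit (Localization.mk p (⟨q, hx⟩ : (P x).primeCompl)) ↔ _
        rw [Localization.mk_eq_mk']
        exact IsLocalization.AtPrime.isUnit_mk'_iff _ (P x) p ⟨q, hx⟩
    exists_eq_div := fun {x} a => by
      obtain ⟨c, rfl⟩ := Proj.fractionToStalk_surjective i' x a
      obtain ⟨⟨m, p, q, hq⟩, rfl⟩ := HomogeneousLocalization.mk_surjective c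
      have hx' : (q : MvPolynomial (Fin (N + 1)) K) ∉ P (genericPoint X) := fun h => hq (hη x h)
      refine ⟨m, p, q, p.2, q.2, hq, ?_⟩
      rw [← (hfrac p.2 q.2 hx').2]
      exact Proj.algebraMap_fractionToStalk i' x p q hq hx' }

end

/-! ### Regularity and vanishing of rational functions -/

namespace AlgebraicGeometry.Scheme
variable {X : Scheme.{u}} [IsIntegral X]

/-- The local ring at a point as a subring of the function field. -/
def regularAt (x : X) : Subring X.functionField :=
  (algebraMap (X.presheaf.stalk x) X.functionField).range

/-- A rational function vanishes at a point if it belongs to the maximal ideal of its local ring. -/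
def VanishesAt (x : X) (f : X.functionField) : Prop :=
  ∃ a ∈ IsLocalRing.maximalIdeal (X.presheaf.stalk x), algebraMap _ X.functionField a = f

theorem algebraMap_stalk_injective (x : X) :
    Function.Injective (algebraMap (X.presheaf.stalk x) X.functionField) :=
  IsFractionRing.injective _ _

theorem algebraMap_stalkSpecializes {z x : X} (h : z ⤳ x) (a : X.presheaf.stalk x) :
    algebraMap _ X.functionField ((X.presheaf.stalkSpecializes h).hom a) =
      algebraMap _ X.functionField a :=
  TopCat.Presheaf.stalkSpecializes_comp_apply X.presheaf
    ((genericPoint_spec X).specializes trivial) h a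

theorem regularAt_le_of_specializes {z x : X} (h : z ⤳ x) : regularAt x ≤ regularAt z := by
  rintro _ ⟨a, rfl⟩
  exact ⟨_, algebraMap_stalkSpecializes h a⟩

theorem vanishesAt_algebraMap {x : X} {a : X.presheaf.stalk x} :
    VanishesAt x (algebraMap _ X.functionField a) ↔
      a ∈ IsLocalRing.maximalIdeal (X.presheaf.stalk x) :=
  ⟨fun ⟨_, hb, h⟩ => algebraMap_stalk_injective x h ▸ hb, fun h => ⟨a, h, rfl⟩⟩

/-- Moves the question into the function field, where the condition no longer involves `x`; local
rings at different points can then be compared. -/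
theorem mem_idealOfGenerization {z x : X} (h : z ⤳ x) {a : X.presheaf.stalk x} :
    a ∈ idealOfGenerization h ↔ VanishesAt z (algebraMap _ X.functionField a) := by
  rw [← algebraMap_stalkSpecializes h, vanishesAt_algebraMap]
  rfl

instance isPrime_idealOfGenerization {z x : X} (h : z ⤳ x) : (idealOfGenerization h).IsPrime :=
  Ideal.comap_isPrime _ _

omit [IsIntegral X] in
theorem idealOfGenerization_le_maximalIdeal {z x : X} (h : z ⤳ x) :
    idealOfGenerization h ≤ IsLocalRing.maximalIdeal (X.presheaf.stalk x) :=
  IsLocalRing.le_maximalIdeal (Ideal.IsPrime.ne_top inferInstance)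

end AlgebraicGeometry.Scheme

open Scheme

namespace HomogeneousCoordinates
variable {K : Type u} [Field K] {X : Scheme.{u}} [IsIntegral X] [Algebra K X.functionField] {N : ℕ}
  (C : HomogeneousCoordinates K X N)

include C in
theorem algebraMap_mem_regularAt (x : X) (c : K) :
    algebraMap K X.functionField c ∈ regularAt x := by
  have := C.isPrime x
  obtain ⟨a, ha, -⟩ := C.exists_algebraMap_eq (MvPolynomial.isHomogeneous_C (Fin (N + 1)) c)
    (MvPolynomial.isHomogeneous_one _ K) (Ideal.one_notMem (C.ideal x))
  exact ⟨a, by simpa using ha⟩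

theorem coord_ne_zero {x : X} {k : Fin (N + 1)} (hk : MvPolynomial.X k ∉ C.ideal x) :
    C.coord k ≠ 0 := by
  simpa using C.aeval_ne_zero (MvPolynomial.isHomogeneous_X K k) hk

theorem X_pow_notMem {x : X} {k : Fin (N + 1)} (hk : MvPolynomial.X k ∉ C.ideal x) (m : ℕ) :
    MvPolynomial.X k ^ m ∉ C.ideal x := fun h => hk ((C.isPrime x).mem_of_pow_mem m h)

theorem aeval_div_pow {m : ℕ} {p : MvPolynomial (Fin (N + 1)) K} (hp : p.IsHomogeneous m)
    (k : Fin (N + 1)) : MvPolynomial.aeval C.coord p / C.coord k ^ m =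
      MvPolynomial.aeval (fun j => C.coord j / C.coord k) p := by
  rw [div_eq_mul_inv, ← inv_pow]
  exact hp.eval₂_mul_pow _ _ _

/-- Forms divided by a power of a coordinate which does not vanish at `x` are regular at `x`, and
vanish at `x` exactly if the form does. -/
theorem exists_algebraMap_eq_div_pow {x : X} {k : Fin (N + 1)} (hk : MvPolynomial.X k ∉ C.ideal x)
    {m : ℕ} {p : MvPolynomial (Fin (N + 1)) K} (hp : p.IsHomogeneous m) :
    ∃ a : X.presheaf.stalk x, algebraMap _ X.functionField a =
      MvPolynomial.aeval C.coord p / C.coord k ^ m ∧ (IsUnit a ↔ p ∉ C.ideal x) := by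
  simpa using C.exists_algebraMap_eq hp (MvPolynomial.isHomogeneous_X_pow k m) (C.X_pow_notMem hk m)

theorem coord_div_mem_regularAt {x : X} {k : Fin (N + 1)} (hk : MvPolynomial.X k ∉ C.ideal x)
    (j : Fin (N + 1)) : C.coord j / C.coord k ∈ regularAt x := by
  obtain ⟨a, ha, -⟩ := C.exists_algebraMap_eq_div_pow hk (MvPolynomial.isHomogeneous_X K j)
  exact ⟨a, by simpa using ha⟩

end HomogeneousCoordinates

/-! ### Charts and Bertini's theorem on the embedded scheme -/

namespace HomogeneousCoordinates
variable {K : Type u} [Field K] {X : Scheme.{u}} [IsIntegral X] [Algebra K X.functionField] {N : ℕ}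
  (C : HomogeneousCoordinates K X N)

/-- The coordinate ring of the chart where the coordinate `k` does not vanish and where
the linear system `f` is generated by its member `j`. -/
def chart {ι : Type*} (f : ι → X.functionField) (k : Fin (N + 1)) (j : ι) :
    Subalgebra K X.functionField :=
  Algebra.adjoin K (Set.range (fun l => C.coord l / C.coord k) ∪ Set.range fun l => f l / f j)

instance {ι : Type*} [Finite ι] (f : ι → X.functionField) (k : Fin (N + 1)) (j : ι) :
    Algebra.FiniteType K (C.chart f k j) :=
  Subalgebra.fg_iff_finiteType _ |>.mp
    (Subalgebra.fg_def.mpr ⟨_, (Set.finite_range _).union (Set.finite_range _), rfl⟩)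

variable {ι : Type*} {f : ι → X.functionField} {k : Fin (N + 1)} {j : ι} {x : X}

theorem chart_le_regularAt (hk : MvPolynomial.X k ∉ C.ideal x)
    (hj : ∀ l, f l / f j ∈ regularAt x) {a : X.functionField} (ha : a ∈ C.chart f k j) :
    a ∈ regularAt x := by
  induction ha using Algebra.adjoin_induction with
  | mem a ha =>
    obtain ⟨l, rfl⟩ | ⟨l, rfl⟩ := ha
    exacts [C.coord_div_mem_regularAt hk l, hj l]
  | algebraMap r => exact C.algebraMap_mem_regularAt x r
  | add a b _ _ ha hb => exact add_mem ha hb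
  | mul a b _ _ ha hb => exact mul_mem ha hb

theorem aeval_div_pow_mem_chart {m : ℕ} {p : MvPolynomial (Fin (N + 1)) K}
    (hp : p.IsHomogeneous m) : MvPolynomial.aeval C.coord p / C.coord k ^ m ∈ C.chart f k j := by
  rw [C.aeval_div_pow hp]
  refine Algebra.adjoin_mono Set.subset_union_left ?_
  rw [Algebra.adjoin_range_eq_range_aeval]
  exact ⟨p, rfl⟩

/-- The inclusion of the coordinate ring of a chart into the local ring at one of its points. -/
theorem exists_chart_to_stalk (hk : MvPolynomial.X k ∉ C.ideal x)
    (hj : ∀ l, f l / f j ∈ regularAt x) :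
    ∃ ρ : C.chart f k j →+* X.presheaf.stalk x,
      (∀ b, algebraMap _ X.functionField (ρ b) = b) ∧
      ∀ a, ∃ b d, IsUnit (ρ d) ∧ a * ρ d = ρ b := by
  let e := RingEquiv.ofBijective (algebraMap (X.presheaf.stalk x) X.functionField).rangeRestrict
    ⟨fun a b h => algebraMap_stalk_injective x (congrArg Subtype.val h),
      RingHom.rangeRestrict_surjective _⟩
  let ρ : C.chart f k j →+* X.presheaf.stalk x := e.symm.toRingHom.comp
    ((C.chart f k j).val.toRingHom.codRestrict (regularAt x)
      fun b => C.chart_le_regularAt hk hj b.2)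
  have hρ : ∀ b, algebraMap _ X.functionField (ρ b) = b := fun b =>
    congrArg Subtype.val (e.apply_symm_apply ⟨b, C.chart_le_regularAt hk hj b.2⟩)
  refine ⟨ρ, hρ, fun a => ?_⟩
  obtain ⟨m, p, q, hp, hq, hx, ha⟩ := C.exists_eq_div a
  refine ⟨⟨_, C.aeval_div_pow_mem_chart hp⟩, ⟨_, C.aeval_div_pow_mem_chart hq⟩, ?_, ?_⟩
  · obtain ⟨d, hd, hu⟩ := C.exists_algebraMap_eq_div_pow hk hq
    rw [show ρ _ = d from algebraMap_stalk_injective x ((hρ _).trans hd.symm)]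
    exact hu.mpr hx
  · apply algebraMap_stalk_injective x
    rw [map_mul, hρ, hρ, ha]
    have := C.aeval_ne_zero hq hx
    simp only
    field_simp

include C in
/-- **Bertini's theorem** on a scheme with homogeneous coordinates over a field of characteristic
zero: given finitely many points, the general member of a finite dimensional linear system has, at
all points where the system has no base points, a local equation which is independent of the
equations of the closures of the given points to first order. -/
theorem exists_bertini [CharZero K] {S : Set X} (hS : S.Finite) {ι : Type*} [Fintype ι]
    (f : ι → X.functionField) : ∃ c : ι → K, ∀ x j, f j ≠ 0 → (∀ l, f l / f j ∈ regularAt x) →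
      ∀ s : X.presheaf.stalk x, algebraMap _ X.functionField s = (∑ l, c l • f l) / f j →
        s ∈ IsLocalRing.maximalIdeal (X.presheaf.stalk x) →
        s ∉ IsLocalRing.maximalIdeal (X.presheaf.stalk x) ^ 2 ⊔
          ⨆ z : {z : X // z ∈ S ∧ z ⤳ x}, idealOfGenerization z.2.2 := by
  classical
  have := hS.to_subtype
  have := Fintype.ofFinite S
  have hmem : ∀ k j l, f l / f j ∈ C.chart f k j := fun k j l =>
    Algebra.subset_adjoin (Or.inr ⟨l, rfl⟩)
  -- Only the members of `S` that specialize to the point considered impose a condition. There are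
  -- finitely many choices of a chart, a generator and a subset `T` of `S`, so finitely many
  -- discriminants have to be avoided.
  let I : ∀ k j, Set S → Ideal (C.chart f k j) := fun k j T =>
    ⨆ z : T, Ideal.span {b | VanishesAt (z : X) (b : X.functionField)}
  have hp : ∀ t : Fin (N + 1) × ι × Set S, ∃ p : MvPolynomial ι K, p ≠ 0 ∧ (f t.2.1 ≠ 0 →
      ∀ c : ι → K, MvPolynomial.eval c p ≠ 0 →
      ∀ q : Ideal (C.chart f t.1 t.2.1), q.IsPrime → I t.1 t.2.1 t.2.2 ≤ q →
        ∑ l, c l • (⟨f l / f t.2.1, hmem t.1 t.2.1 l⟩ : C.chart f t.1 t.2.1) ∈ q → ∀ b ∉ q,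
        b * ∑ l, c l • (⟨f l / f t.2.1, hmem t.1 t.2.1 l⟩ : C.chart f t.1 t.2.1) ∉
          q ^ 2 ⊔ I t.1 t.2.1 t.2.2) := fun ⟨k, j, T⟩ => by
    by_cases hj : f j = 0
    · exact ⟨1, one_ne_zero, fun h => absurd hj h⟩
    · obtain ⟨p, hp0, hp⟩ := Algebra.FiniteType.exists_bertini (K := K) (I k j T)
        (fun l => (⟨f l / f j, hmem k j l⟩ : C.chart f k j)) (i₀ := j)
        (Subtype.ext (div_self hj))
      exact ⟨p, hp0, fun _ => hp⟩
  choose p hp0 hp using hp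
  -- A nonzero polynomial over an infinite field does not vanish identically as a function.
  obtain ⟨c, hc⟩ : ∃ c : ι → K, MvPolynomial.eval c (∏ t, p t) ≠ 0 := by
    by_contra! h
    have h0 : ∏ t, p t = 0 := MvPolynomial.funext fun c => by rw [h c, map_zero]
    exact Finset.prod_ne_zero_iff.mpr (fun t _ => hp0 t) h0
  refine ⟨c, fun x j hj0 hj s hs hsm hsmem => ?_⟩
  obtain ⟨k, hk⟩ := C.exists_X_notMem x
  obtain ⟨ρ, hρ, hfrac⟩ := C.exists_chart_to_stalk hk hj
  let T : Set S := {z | (z : X) ⤳ x}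
  have hct : MvPolynomial.eval c (p (k, j, T)) ≠ 0 := fun h => hc (by
    rw [map_prod]; exact Finset.prod_eq_zero (Finset.mem_univ (k, j, T)) h)
  let 𝔪 := IsLocalRing.maximalIdeal (X.presheaf.stalk x)
  let q := 𝔪.comap ρ
  let s' : C.chart f k j := ∑ l, c l • ⟨f l / f j, hmem k j l⟩
  have hs' : ρ s' = s := algebraMap_stalk_injective x (by
    rw [hρ, hs, Finset.sum_div]
    simp [s', smul_div_assoc])
  have hJ : ∀ z : T, Ideal.span {b : C.chart f k j | VanishesAt (z : X) (b : X.functionField)} =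
      (idealOfGenerization z.2).comap ρ := fun z => by
    refine le_antisymm (Ideal.span_le.mpr fun b hb => ?_) fun b hb => Ideal.subset_span ?_
    · rw [SetLike.mem_coe, Ideal.mem_comap, mem_idealOfGenerization, hρ]; exact hb
    · rw [Ideal.mem_comap, mem_idealOfGenerization, hρ] at hb; exact hb
  have hI : I k j T ≤ q := iSup_le fun z => by
    rw [hJ z]
    exact Ideal.comap_mono (idealOfGenerization_le_maximalIdeal z.2)
  let : Algebra (C.chart f k j) (X.presheaf.stalk x) := ρ.toAlgebra
  have hinj : Function.Injective ρ := fun a b h => Subtype.ext (by rw [← hρ, ← hρ, h])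
  have hunit : ∀ b, IsUnit (ρ b) ↔ b ∉ q := fun b => by
    rw [Ideal.mem_comap, IsLocalRing.notMem_maximalIdeal]
  have hloc : IsLocalization.AtPrime (X.presheaf.stalk x) q :=
    ⟨fun d => (hunit d).mpr d.2, fun a => by
      obtain ⟨b, d, hd, h⟩ := hfrac a
      exact ⟨(b, ⟨d, (hunit d).mp hd⟩), h⟩, fun {a b} h => ⟨1, by rw [hinj h]⟩⟩
  have hmap : ∀ J : Ideal (X.presheaf.stalk x), J ≤ (J.comap ρ).map ρ := fun J =>
    (IsLocalization.map_under q.primeCompl _ J).ge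
  have hle : 𝔪 ^ 2 ⊔ ⨆ z : {z : X // z ∈ S ∧ z ⤳ x}, idealOfGenerization z.2.2 ≤
      (q ^ 2 ⊔ I k j T).map ρ := by
    rw [Ideal.map_sup, Ideal.map_pow]
    refine sup_le_sup (Ideal.pow_right_mono (hmap 𝔪) 2) (iSup_le fun z => (hmap _).trans ?_)
    refine Ideal.map_mono ?_
    rw [← hJ ⟨⟨z, z.2.1⟩, z.2.2⟩]
    exact le_iSup (fun z : T =>
      Ideal.span {b : C.chart f k j | VanishesAt (z : X) (b : X.functionField)}) ⟨⟨z, z.2.1⟩, z.2.2⟩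
  -- Membership in the local ring descends to the chart up to a denominator `d` outside `q`; this is
  -- why the affine theorem allows a factor outside the prime.
  obtain ⟨⟨b, d⟩, hbd⟩ := (IsLocalization.mem_map_algebraMap_iff q.primeCompl _).mp (hle hsmem)
  refine hp (k, j, T) hj0 c hct q (Ideal.comap_isPrime _ _) hI ?_ d d.2 ?_
  · rw [Ideal.mem_comap]; change ρ s' ∈ _; rw [hs']; exact hsm
  · have : (d : C.chart f k j) * s' = b := hinj (by
      rw [mul_comm, map_mul, hs']; exact hbd)
    change d * s' ∈ _
    rw [this]; exact b.2

end HomogeneousCoordinates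

/-! ### Linear systems and normal crossings -/

namespace AlgebraicGeometry.Scheme
variable {X : Scheme.{u}} [IsIntegral X]

theorem VanishesAt.mul {x : X} {f g : X.functionField} (hf : VanishesAt x f)
    (hg : g ∈ regularAt x) : VanishesAt x (f * g) := by
  obtain ⟨a, ha, rfl⟩ := hf
  obtain ⟨b, rfl⟩ := hg
  exact ⟨a * b, Ideal.mul_mem_right _ _ ha, map_mul _ _ _⟩

/-- The member `j` of the linear system `f` generates it near `x`. -/
structure IsLocalGenerator {ι : Type*} (f : ι → X.functionField) (x : X) (j : ι) : Prop where
  ne_zero : f j ≠ 0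
  div_mem_regularAt (l : ι) : f l / f j ∈ regularAt x

/-- The movable part of the divisor of the member `g` of the linear system `f`. -/
def movableSupport {ι : Type*} (f : ι → X.functionField) (g : X.functionField) : Set X :=
  {z | Order.coheight z = 1 ∧ ∃ j, IsLocalGenerator f z j ∧ VanishesAt z (g / f j)}

theorem VanishesAt.div_of_isLocalGenerator {ι : Type*} {f : ι → X.functionField} {x : X} {i j : ι}
    {g : X.functionField} (hg : VanishesAt x (g / f i)) (hi : IsLocalGenerator f x i)
    (hj : IsLocalGenerator f x j) : VanishesAt x (g / f j) := by
  have h := hg.mul (hj.div_mem_regularAt i)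
  rwa [div_mul_div_cancel₀ hi.ne_zero] at h

theorem IsLocalGenerator.of_specializes {ι : Type*} {f : ι → X.functionField} {z x : X} {j : ι}
    (h : z ⤳ x) (hj : IsLocalGenerator f x j) : IsLocalGenerator f z j :=
  ⟨hj.ne_zero, fun l => regularAt_le_of_specializes h (hj.div_mem_regularAt l)⟩

end AlgebraicGeometry.Scheme

namespace HomogeneousCoordinates
variable {K : Type u} [Field K] {X : Scheme.{u}} [IsIntegral X] [Algebra K X.functionField] {N : ℕ}
  (C : HomogeneousCoordinates K X N)

/-- The ideals of points are homogeneous, so inclusions can be tested on forms. -/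
theorem ideal_le_of_isHomogeneous {z x : X} (h : ∀ m p, p.IsHomogeneous m → p ∈ C.ideal z →
    p ∈ C.ideal x) : z ⤳ x := by
  refine C.specializes_iff.mpr fun p hp => ?_
  rw [← p.sum_homogeneousComponent]
  exact Ideal.sum_mem _ fun m _ => h m _ (MvPolynomial.homogeneousComponent_isHomogeneous m p)
    (C.isHomogeneous z hp m)

theorem mem_idealOfGenerization_iff {z x : X} (h : z ⤳ x) {k : Fin (N + 1)}
    (hk : MvPolynomial.X k ∉ C.ideal x) {m : ℕ} {p : MvPolynomial (Fin (N + 1)) K}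
    (hp : p.IsHomogeneous m) {a : X.presheaf.stalk x} (ha : algebraMap _ X.functionField a =
      MvPolynomial.aeval C.coord p / C.coord k ^ m) :
    a ∈ idealOfGenerization h ↔ p ∈ C.ideal z := by
  obtain ⟨b, hb, hu⟩ := C.exists_algebraMap_eq_div_pow
    (fun h' => hk (C.specializes_iff.mp h h')) hp
  rw [mem_idealOfGenerization, ha, ← hb, vanishesAt_algebraMap, IsLocalRing.mem_maximalIdeal,
    mem_nonunits_iff, hu, not_not]

include C in
-- A form divided by a power of a coordinate is a germ at x, and it lies in the ideal of a
-- generization exactly if the form vanishes there. Applied in both directions, this shows that two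
-- components with the same equation at x coincide.
theorem specializes_of_idealOfGenerization_le {z w x : X} (hz : z ⤳ x) (hw : w ⤳ x)
    (h : idealOfGenerization hz ≤ idealOfGenerization hw) : z ⤳ w := by
  refine C.ideal_le_of_isHomogeneous fun m p hp hpz => ?_
  obtain ⟨k, hk⟩ := C.exists_X_notMem x
  obtain ⟨a, ha, -⟩ := C.exists_algebraMap_eq_div_pow hk hp
  exact (C.mem_idealOfGenerization_iff hw hk hp ha).mp
    (h ((C.mem_idealOfGenerization_iff hz hk hp ha).mpr hpz))

include C in
-- The local ring at z is the localization of the one at x: a fraction of forms regular at z becomes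
-- a quotient of germs at x after dividing both forms by the same power of a coordinate.
theorem height_idealOfGenerization {z x : X} (h : z ⤳ x) :
    (idealOfGenerization h).height = Order.coheight z := by
  let : Algebra (X.presheaf.stalk x) (X.presheaf.stalk z) :=
    (X.presheaf.stalkSpecializes h).hom.toAlgebra
  have hmap : ∀ a, algebraMap _ X.functionField (algebraMap _ (X.presheaf.stalk z) a) =
      algebraMap (X.presheaf.stalk x) X.functionField a := algebraMap_stalkSpecializes h
  have hunit : ∀ a, IsUnit (algebraMap (X.presheaf.stalk x) (X.presheaf.stalk z) a) ↔
      a ∉ idealOfGenerization h := fun a => by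
    rw [idealOfGenerization, Ideal.mem_comap, IsLocalRing.notMem_maximalIdeal]; rfl
  have hloc : IsLocalization.AtPrime (X.presheaf.stalk z) (idealOfGenerization h) :=
    ⟨fun d => (hunit d).mpr d.2, fun a => by
      obtain ⟨m, p, q, hp, hq, hz, ha⟩ := C.exists_eq_div a
      obtain ⟨k, hk⟩ := C.exists_X_notMem x
      have hkz : MvPolynomial.X k ∉ C.ideal z := fun h' => hk (C.specializes_iff.mp h h')
      obtain ⟨b, hb, -⟩ := C.exists_algebraMap_eq_div_pow hk hp
      obtain ⟨d, hd, -⟩ := C.exists_algebraMap_eq_div_pow hk hq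
      obtain ⟨d', hd', hu⟩ := C.exists_algebraMap_eq_div_pow hkz hq
      have hdd' : algebraMap (X.presheaf.stalk x) (X.presheaf.stalk z) d = d' :=
        algebraMap_stalk_injective z (by rw [hmap, hd, hd'])
      refine ⟨(b, ⟨d, (hunit d).mp (hdd' ▸ hu.mpr hz)⟩), algebraMap_stalk_injective z ?_⟩
      have h1 := C.aeval_ne_zero hq hz
      rw [map_mul, hmap, hmap, hb, hd, ha]
      field_simp, fun {a b} hab => ⟨1, by
        rw [algebraMap_stalk_injective x ((hmap a).symm.trans ((congrArg _ hab).trans (hmap b)))]⟩⟩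
  have h1 := IsLocalization.AtPrime.ringKrullDim_eq_height (idealOfGenerization h)
    (X.presheaf.stalk z)
  rw [ringKrullDim_stalk_eq_coheight] at h1
  exact_mod_cast h1.symm

include C in
theorem exists_algebraMap_eq_sum_div {ι : Type*} [Fintype ι] {f : ι → X.functionField} {x : X}
    {j : ι} (hj : IsLocalGenerator f x j) (c : ι → K) :
    ∃ s : X.presheaf.stalk x, algebraMap _ X.functionField s = (∑ l, c l • f l) / f j := by
  change (∑ l, c l • f l) / f j ∈ regularAt x
  rw [Finset.sum_div]
  refine sum_mem fun l _ => ?_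
  rw [Algebra.smul_def, mul_div_assoc]
  exact mul_mem (C.algebraMap_mem_regularAt x (c l)) (hj.div_mem_regularAt l)

variable [IsLocallyNoetherian X]

include C in
/-- **Bertini's theorem** for simple normal crossing divisors: the movable part of the divisor of a
general member of a linear system without base points crosses a given simple normal crossing
divisor normally, and has no component in common with it. -/
theorem exists_isSimpleNormalCrossing_union [CharZero K] {S : Set X} (hS : S.Finite)
    (hSNC : IsSimpleNormalCrossing S) {ι : Type*} [Fintype ι] (f : ι → X.functionField)
    (hf : ∀ x, ∃ j, IsLocalGenerator f x j) : ∃ c : ι → K, ∑ l, c l • f l ≠ 0 ∧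
      IsSimpleNormalCrossing (S ∪ movableSupport f (∑ l, c l • f l)) ∧
      Disjoint S (movableSupport f (∑ l, c l • f l)) := by
  classical
  obtain ⟨c, hc⟩ := C.exists_bertini hS f
  have hcs : ∀ x j, IsLocalGenerator f x j → ∀ s : X.presheaf.stalk x,
      algebraMap _ X.functionField s = (∑ l, c l • f l) / f j →
        s ∈ IsLocalRing.maximalIdeal (X.presheaf.stalk x) →
        s ∉ IsLocalRing.maximalIdeal (X.presheaf.stalk x) ^ 2 ⊔
          ⨆ z : {z : X // z ∈ S ∧ z ⤳ x}, idealOfGenerization z.2.2 :=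
    fun x j hj => hc x j hj.ne_zero hj.div_mem_regularAt
  refine ⟨c, fun h0 => ?_, fun x => ?_, Set.disjoint_left.mpr fun z hzS hzA => ?_⟩
  -- The zero member would have local equation 0, which lies in every ideal.
  · obtain ⟨j, hj⟩ := hf (genericPoint X)
    exact hcs _ j hj 0 (by simp [h0]) (zero_mem _) (zero_mem _)
  · obtain ⟨d, t, hd, ht, e, he, hte⟩ := hSNC x
    obtain ⟨j, hj⟩ := hf x
    obtain ⟨s, hs⟩ := C.exists_algebraMap_eq_sum_div hj c
    have hsz : ∀ z (hz : z ⤳ x), z ∈ movableSupport f (∑ l, c l • f l) →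
        s ∈ idealOfGenerization hz := fun z hz ⟨_, i, hi, hv⟩ => by
      rw [mem_idealOfGenerization, hs]
      exact hv.div_of_isLocalGenerator hi (hj.of_specializes hz)
    by_cases hsm : s ∈ IsLocalRing.maximalIdeal (X.presheaf.stalk x)
    · have hsC := hcs x j hj s hs hsm
      -- The equation `s` replaces a parameter which is not the equation of a component in `S`.
      obtain ⟨i, hi, hspan⟩ := IsLocalRing.exists_span_update_eq_maximalIdeal ht
        (C := Set.range e) hsm (by
          rw [← Set.range_comp, Ideal.span_range_eq_iSup]
          simpa only [Function.comp_apply, hte] using hsC)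
      have hprime := IsLocalRing.isPrime_span_singleton_of_span_range_eq hd hspan i
      rw [Function.update_self] at hprime
      have hs0 : s ≠ 0 := fun h => hsC (h ▸ zero_mem _)
      have hideal : ∀ z (hz : z ⤳ x), z ∈ movableSupport f (∑ l, c l • f l) →
          idealOfGenerization hz = Ideal.span {s} := fun z hz hzA => by
        have hle : Ideal.span {s} ≤ idealOfGenerization hz :=
          (Ideal.span_singleton_le_iff_mem _).mpr (hsz z hz hzA)
        -- Strict inclusion of the prime (s) in a prime of height one would force s = 0. So all new
        -- components through x have the ideal (s), and there is at most one.
        refine (hle.eq_of_not_lt fun hlt => hs0 ?_).symm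
        have h1 := Ideal.height_strict_mono_of_isPrime_of_isPrime hlt
        rw [C.height_idealOfGenerization, hzA.1, Order.lt_one_iff,
          Ideal.height_eq_zero_iff_eq_bot, Ideal.span_singleton_eq_bot] at h1
        exact h1
      have he' : ∀ z : {z : X // z ∈ S ∪ movableSupport f (∑ l, c l • f l) ∧ z ⤳ x},
          (z : X) ∉ S → (z : X) ∈ movableSupport f (∑ l, c l • f l) :=
        fun z hz => z.2.1.resolve_left hz
      refine ⟨d, Function.update t i s, hd, hspan,
        fun z => if h : (z : X) ∈ S then e ⟨z, h, z.2.2⟩ else i, fun z w hzw => ?_, fun z => ?_⟩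
      · by_cases hz : (z : X) ∈ S <;> by_cases hw : (w : X) ∈ S <;>
          simp only [hz, hw, dif_pos, dif_neg, not_false_eq_true] at hzw
        · exact Subtype.ext (Subtype.mk.inj (he hzw))
        · exact absurd ⟨_, hzw⟩ hi
        · exact absurd ⟨_, hzw.symm⟩ hi
        · have h1 := hideal z z.2.2 (he' z hz)
          have h2 := hideal w w.2.2 (he' w hw)
          exact Subtype.ext ((C.specializes_of_idealOfGenerization_le z.2.2 w.2.2
            (h1.trans h2.symm).le).antisymm (C.specializes_of_idealOfGenerization_le w.2.2 z.2.2
            (h2.trans h1.symm).le)).eq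
      · by_cases hz : (z : X) ∈ S
        · have hne : e ⟨z, hz, z.2.2⟩ ≠ i := fun h => hi ⟨_, h⟩
          simp only [hz, dif_pos, Function.update_of_ne hne]
          exact hte ⟨z, hz, z.2.2⟩
        · simp only [hz, dif_neg, not_false_eq_true, Function.update_self]
          exact hideal z z.2.2 (he' z hz)
    -- Here `s` is a unit at x, so no new component passes through x.
    · have hzS : ∀ z : {z : X // z ∈ S ∪ movableSupport f (∑ l, c l • f l) ∧ z ⤳ x},
          (z : X) ∈ S := fun z => z.2.1.resolve_right fun hz =>
        hsm (idealOfGenerization_le_maximalIdeal z.2.2 (hsz z z.2.2 hz))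
      exact ⟨d, t, hd, ht, fun z => e ⟨z, hzS z, z.2.2⟩, fun z w hzw =>
        Subtype.ext (Subtype.mk.inj (he hzw)), fun z => hte ⟨z, hzS z, z.2.2⟩⟩
  -- At a common component z, the equation lies in the maximal ideal at z, which is itself the ideal
  -- of a member of `S`.
  · obtain ⟨-, j, hj, a, ham, ha⟩ := hzA
    refine hcs z j hj a ha ham (Ideal.mem_sup_right ?_)
    refine Ideal.mem_iSup_of_mem ⟨z, hzS, specializes_rfl⟩ ?_
    rw [mem_idealOfGenerization, vanishesAt_algebraMap]
    exact ham

end HomogeneousCoordinates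

/-! ### Codimension one points and orders -/

theorem IsSimpleNormalCrossing.mono {X : Scheme.{u}} {S T : Set X} (hT : IsSimpleNormalCrossing T)
    (h : S ⊆ T) : IsSimpleNormalCrossing S := fun x => by
  obtain ⟨d, t, hd, ht, c, hc, htc⟩ := hT x
  exact ⟨d, t, hd, ht, fun z => c ⟨z, h z.2.1, z.2.2⟩,
    fun z w hzw => Subtype.ext (Subtype.mk.inj (hc hzw)), fun z => htc ⟨z, h z.2.1, z.2.2⟩⟩

theorem not_specializes_of_coheight_eq {X : Scheme.{u}} {z w : X} {n : ℕ}
    (hz : Order.coheight z = n) (hw : Order.coheight w = n) (hne : z ≠ w) : ¬ z ⤳ w := fun h => by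
  have h1 := Order.coheight_strictAnti (lt_of_le_not_ge h fun h' => hne (h.antisymm h').eq : w < z)
    (hz.trans_lt (ENat.natCast_lt_top n))
  rw [hz, hw] at h1
  exact lt_irrefl _ h1

/-- Such points are generic points of irreducible components of Z: otherwise the generic point of
the component would have codimension 0 and be the generic point of X. -/
theorem finite_setOf_coheight_eq_one {X : Scheme.{u}} [IsIntegral X]
    [TopologicalSpace.NoetherianSpace X] {Z : Set X} (hZ : IsClosed Z) (hη : genericPoint X ∉ Z) :
    {z ∈ Z | Order.coheight z = 1}.Finite := by
  obtain ⟨T, hT, hcl, hirr, rfl⟩ :=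
    TopologicalSpace.NoetherianSpace.exists_finite_set_isClosed_irreducible hZ
  have := hT.to_subtype
  refine (Set.finite_range fun t : T => (hirr t t.2).genericPoint).subset ?_
  rintro z ⟨⟨t, htT, hzt⟩, hz⟩
  refine ⟨⟨t, htT⟩, ?_⟩
  have hspec := (hirr t htT).isGenericPoint_genericPoint_closure
  rw [(hcl t htT).closure_eq] at hspec
  by_contra hne
  have hle : (hirr t htT).genericPoint ⤳ z := hspec.specializes hzt
  have hlt : z < (hirr t htT).genericPoint :=
    lt_of_le_not_ge hle fun h => hne (hle.antisymm h).eq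
  have h1 := Order.coheight_strictAnti hlt
    (((Order.coheight_anti hlt.le).trans_eq hz).trans_lt (ENat.natCast_lt_top 1))
  rw [hz, Order.lt_one_iff, Order.coheight_eq_zero] at h1
  have h2 : (hirr t htT).genericPoint ⤳ genericPoint X :=
    h1 (show _ ≤ genericPoint X from (genericPoint_spec X).specializes trivial)
  exact hη ⟨t, htT, h2.mem_closed (hcl t htT) hspec.mem⟩

namespace AlgebraicGeometry.Scheme
variable {X : Scheme.{u}} [IsIntegral X] [IsLocallyNoetherian X]

theorem ord_algebraMap_of_isUnit {z : X} {a : X.presheaf.stalk z} (ha : IsUnit a) :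
    ord (algebraMap _ X.functionField a) z = 0 := by
  by_cases hz : Order.coheight z = 1
  · have : Ring.KrullDimLE 1 (X.presheaf.stalk z) := krullDimLE_of_coheight_le hz.le
    rw [ord_eq_iff hz ((map_ne_zero_iff _ (algebraMap_stalk_injective z)).mpr ha.ne_zero)]
    exact Ring.ordFrac_of_isUnit ha
  · exact ord_eq_zero_of_coheight_neq_one hz _

/-- The order of a germ a is the length of 𝒪/(a), which is finite because a ≠ 0 and positive because
a is not a unit. -/
theorem ord_ne_zero_of_vanishesAt {z : X} (hz : Order.coheight z = 1) {f : X.functionField}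
    (hf : f ≠ 0) (h : VanishesAt z f) : ord f z ≠ 0 := by
  obtain ⟨a, ha, rfl⟩ := h
  have : Ring.KrullDimLE 1 (X.presheaf.stalk z) := krullDimLE_of_coheight_le hz.le
  have ha0 : a ≠ 0 := fun h => hf (by rw [h, map_zero])
  have ha' := mem_nonZeroDivisors_iff_ne_zero.mpr ha0
  rw [Ne, ord_eq_iff hz hf]
  change Ring.ordFrac (X.presheaf.stalk z) _ ≠ _
  rw [Ring.ordFrac_eq_ord _ ha0]
  have h2 := Ring.ord_ne_top ha'
  have h3 : Ring.ord (X.presheaf.stalk z) a ≠ 0 := by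
    rw [Ring.ord, Ne, Module.length_eq_zero_iff, Ideal.Quotient.subsingleton_iff]
    rw [Ideal.span_singleton_eq_top]
    exact ha
  obtain ⟨n, hn⟩ := ENat.ne_top_iff_exists.mp h2
  rw [Ring.ordMonoidWithZeroHom_eq_coe _ ha' hn.symm]
  intro h
  have h4 := Multiplicative.ofAdd.injective (WithZero.coe_injective h)
  rw [← hn] at h3
  exact h3 (by exact_mod_cast h4)

theorem ord_eq_zero_of_not_vanishesAt {z : X} {f : X.functionField}
    (hf : f ∈ regularAt z) (h : ¬ VanishesAt z f) : ord f z = 0 := by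
  obtain ⟨a, rfl⟩ := hf
  rw [vanishesAt_algebraMap, IsLocalRing.notMem_maximalIdeal] at h
  exact ord_algebraMap_of_isUnit h

/-- A nonzero rational function is a unit on some nonempty open set, so its divisor lies in a proper
closed subset. -/
theorem finite_ord_ne_zero [TopologicalSpace.NoetherianSpace X] {f : X.functionField}
    (hf : f ≠ 0) : {z | ord f z ≠ 0}.Finite := by
  obtain ⟨U, -, f', hU, rfl, hu⟩ := exists_isUnit_germ_eq X f hf
  refine (finite_setOf_coheight_eq_one U.isOpen.isClosed_compl fun h => h
    (((genericPoint_spec X).mem_open_set_iff U.isOpen).mpr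
      (by simpa using Set.nonempty_coe_sort.mp hU))).subset fun z hz => ⟨fun hzU => hz
    (ord_of_isUnit hu hzU), ?_⟩
  by_contra h
  exact hz (ord_eq_zero_of_coheight_neq_one h _)

theorem finite_movableSupport [TopologicalSpace.NoetherianSpace X] {ι : Type*} [Finite ι]
    (f : ι → X.functionField) {g : X.functionField} (hg : g ≠ 0) :
    (movableSupport f g).Finite := by
  refine (Set.finite_iUnion fun j : {j // f j ≠ 0} =>
    finite_ord_ne_zero (div_ne_zero hg j.2)).subset ?_
  rintro z ⟨hz, j, hj, hv⟩
  exact Set.mem_iUnion.mpr ⟨⟨j, hj.ne_zero⟩,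
    ord_ne_zero_of_vanishesAt hz (div_ne_zero hg hj.ne_zero) hv⟩

theorem ord_div {x : X} {f g : X.functionField} (hf : f ≠ 0) (hg : g ≠ 0) :
    ord (f / g) x = ord f x - ord g x := by
  have h := ord_mul (x := x) (div_ne_zero hf hg) hg
  rw [div_mul_cancel₀ _ hg] at h
  lia

theorem ord_pow {x : X} {f : X.functionField} (hf : f ≠ 0) (n : ℕ) :
    ord (f ^ n) x = n * ord f x := by
  induction n with
  | zero => simpa using ord_mul (x := x) (one_ne_zero (α := X.functionField)) one_ne_zero
  | succ n ih => rw [pow_succ, ord_mul (pow_ne_zero n hf) hf, ih]; push_cast; ring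

end AlgebraicGeometry.Scheme

/-! ### Forms through a prime divisor and the moving lemma -/

namespace HomogeneousCoordinates
variable {K : Type u} [Field K] {X : Scheme.{u}} [IsIntegral X] [Algebra K X.functionField] {N : ℕ}
  (C : HomogeneousCoordinates K X N)

/-- Setting X_k = 1, as a ring homomorphism on all polynomials, so that ideals of germs can be
pulled back. The one-member system 1 makes the chart the usual affine one. -/
theorem exists_dehomogenization {x : X} {k : Fin (N + 1)} (hk : MvPolynomial.X k ∉ C.ideal x) :
    ∃ ψ : MvPolynomial (Fin (N + 1)) K →+* X.presheaf.stalk x, ψ (MvPolynomial.X k) = 1 ∧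
      ∀ m p, p.IsHomogeneous m → algebraMap _ X.functionField (ψ p) =
        MvPolynomial.aeval C.coord p / C.coord k ^ m ∧ (IsUnit (ψ p) ↔ p ∉ C.ideal x) := by
  obtain ⟨ρ, hρ, -⟩ := C.exists_chart_to_stalk (f := fun _ : Unit => (1 : X.functionField))
    (j := ()) hk (fun _ => by rw [div_self one_ne_zero]; exact one_mem _)
  let φ : MvPolynomial (Fin (N + 1)) K →ₐ[K] C.chart (fun _ : Unit => (1 : X.functionField)) k () :=
    MvPolynomial.aeval fun j =>
      ⟨C.coord j / C.coord k, Algebra.subset_adjoin (Or.inl ⟨j, rfl⟩)⟩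
  have hφ : ∀ p, algebraMap _ X.functionField (ρ (φ p)) =
      MvPolynomial.aeval (fun j => C.coord j / C.coord k) p := fun p => by
    rw [hρ]
    exact MvPolynomial.comp_aeval_apply _ (C.chart _ k ()).val p
  refine ⟨ρ.comp φ.toRingHom, algebraMap_stalk_injective x ?_, fun m p hp => ?_⟩
  · change algebraMap _ X.functionField (ρ (φ _)) = _
    rw [hφ, MvPolynomial.aeval_X, div_self (C.coord_ne_zero hk), map_one]
  · obtain ⟨a, ha, hu⟩ := C.exists_algebraMap_eq_div_pow hk hp
    rw [show (ρ.comp φ.toRingHom) p = a from algebraMap_stalk_injective x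
      ((hφ p).trans ((C.aeval_div_pow hp k).symm.trans ha.symm))]
    exact ⟨ha, hu⟩

/-- Forms of one degree m that generate the ideal of D on every chart. As D is locally principal,
one of them is locally an equation of D and divides the others, so D is the whole fixed part. -/
theorem exists_linearSystem [IsLocallyNoetherian X] {D : X} (hD : Order.coheight D = 1)
    (hprin : ∀ x (h : D ⤳ x), ∃ t, idealOfGenerization h = Ideal.span {t}) :
    ∃ (m : ℕ) (ι : Type u) (_ : Fintype ι) (f : ι → X.functionField),
      (∀ x, ∃ j, IsLocalGenerator f x j) ∧
      ∀ z k, Order.coheight z = 1 → MvPolynomial.X k ∉ C.ideal z → ∃ j, IsLocalGenerator f z j ∧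
        (ord (f j / C.coord k ^ m) z = 0 ↔ z ≠ D) := by
  classical
  obtain ⟨T, hT⟩ : (C.ideal D).FG := IsNoetherian.noetherian _
  -- The homogeneous components of the generators are raised to the common degree m by powers of
  -- every variable; on the chart X_k = 1 those multiplied by powers of X_k become the components
  -- themselves.
  let m := T.sup MvPolynomial.totalDegree
  let ι := T × Fin (m + 1) × Fin (N + 1)
  let q : ι → MvPolynomial (Fin (N + 1)) K := fun l =>
    MvPolynomial.X l.2.2 ^ (m - l.2.1) * (l.1 : MvPolynomial _ K).homogeneousComponent l.2.1
  have hqh : ∀ l, (q l).IsHomogeneous m := fun l => by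
    have h := (MvPolynomial.isHomogeneous_X_pow (R := K) l.2.2 (m - l.2.1)).mul
      (MvPolynomial.homogeneousComponent_isHomogeneous l.2.1 (l.1 : MvPolynomial _ K))
    rwa [Nat.sub_add_cancel (Nat.lt_succ_iff.mp l.2.1.2)] at h
  have hqD : ∀ l, q l ∈ C.ideal D := fun l => Ideal.mul_mem_left _ _
    (C.isHomogeneous D (hT ▸ Ideal.subset_span l.1.2) _)
  have hsum : ∀ p ∈ T, p = ∑ i : Fin (m + 1), p.homogeneousComponent i := fun p hp => by
    rw [Fin.sum_univ_eq_sum_range (fun i => p.homogeneousComponent i)]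
    conv_lhs => rw [← p.sum_homogeneousComponent]
    refine Finset.sum_subset (Finset.range_mono (Nat.succ_le_succ (Finset.le_sup hp))) fun i _ hi =>
      MvPolynomial.homogeneousComponent_eq_zero _ _ (by simpa using hi)
  let f : ι → X.functionField := fun l => MvPolynomial.aeval C.coord (q l)
  have main : ∀ x k, MvPolynomial.X k ∉ C.ideal x → ∃ j, IsLocalGenerator f x j ∧
      ∃ a : X.presheaf.stalk x, algebraMap _ X.functionField a = f j / C.coord k ^ m ∧
        (¬ D ⤳ x → IsUnit a) := fun x k hk => by
    obtain ⟨ψ, hψk, hψ⟩ := C.exists_dehomogenization hk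
    have hy := pow_ne_zero m (C.coord_ne_zero hk)
    have hgen : ∀ (j : ι) (t : X.presheaf.stalk x) (b : ι → X.presheaf.stalk x), t ≠ 0 →
        (∀ l, ψ (q l) = b l * t) → IsUnit (b j) → IsLocalGenerator f x j := fun j t b ht hb hj => by
      have hft : ∀ l, f l / C.coord k ^ m = algebraMap _ X.functionField (b l) *
          algebraMap _ X.functionField t := fun l => by
        rw [← map_mul, ← hb, (hψ m _ (hqh l)).1]
      have ht' := (map_ne_zero_iff _ (algebraMap_stalk_injective x)).mpr ht
      have hj' := (map_ne_zero_iff _ (algebraMap_stalk_injective x)).mpr hj.ne_zero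
      obtain ⟨v, hv⟩ := hj.exists_right_inv
      have hv' := congrArg (algebraMap _ X.functionField) hv
      rw [map_mul, map_one] at hv'
      refine ⟨fun h => ?_, fun l => ⟨b l * v, ?_⟩⟩
      · have := hft j
        rw [h, zero_div] at this
        exact mul_ne_zero hj' ht' this.symm
      · rw [← div_div_div_cancel_right₀ hy, hft, hft, mul_div_mul_right _ _ ht', map_mul,
          eq_div_iff hj', mul_assoc, mul_comm (algebraMap _ _ v), hv', mul_one]
    by_cases hDx : D ⤳ x
    · obtain ⟨t, ht⟩ := hprin x hDx
      have ht0 : t ≠ 0 := fun h => by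
        have h1 := C.height_idealOfGenerization hDx
        rw [ht, h, hD, Ideal.span_singleton_eq_bot.mpr rfl, Ideal.height_bot] at h1
        exact zero_ne_one h1
      have hb : ∀ l, ∃ b, ψ (q l) = b * t := fun l => by
        have : ψ (q l) ∈ idealOfGenerization hDx :=
          (C.mem_idealOfGenerization_iff hDx hk (hqh l) (hψ m _ (hqh l)).1).mpr (hqD l)
        rw [ht] at this
        obtain ⟨b, hb⟩ := Ideal.mem_span_singleton'.mp this
        exact ⟨b, hb.symm⟩
      choose b hb using hb
      -- An equation t of D is a fraction of forms whose numerator vanishes on D, hence lies in the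
      -- ideal generated by `T`; the denominator is a unit at x.
      have htJ : t ∈ Ideal.span (Set.range fun l => ψ (q l)) := by
        obtain ⟨e, p, r, hp, hr, hrx, htpr⟩ := C.exists_eq_div t
        have hte : t * ψ r = ψ p := algebraMap_stalk_injective x (by
          rw [map_mul, (hψ e _ hr).1, (hψ e _ hp).1, htpr]
          have := C.aeval_ne_zero hr hrx
          field_simp)
        have hpD : p ∈ C.ideal D := by
          rw [← C.mem_idealOfGenerization_iff hDx hk hp (hψ e _ hp).1, ← hte, ht]
          exact Ideal.mul_mem_right _ _ (Ideal.mem_span_singleton_self t)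
        have hle : C.ideal D ≤ (Ideal.span (Set.range fun l => ψ (q l))).comap ψ := by
          rw [← hT, Ideal.span_le]
          intro p hp
          rw [SetLike.mem_coe, Ideal.mem_comap, hsum p hp, map_sum]
          refine Ideal.sum_mem _ fun i _ => Ideal.subset_span ⟨(⟨p, hp⟩, i, k), ?_⟩
          simp only [q]
          rw [map_mul, map_pow, hψk, one_pow, one_mul]
        have := hle hpD
        rw [Ideal.mem_comap, ← hte] at this
        exact (Ideal.mul_unit_mem_iff_mem _ ((hψ e _ hr).2.mpr hrx)).mp this
      -- Otherwise t would lie in 𝔪 t, and cancelling t would put 1 into 𝔪.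
      obtain ⟨j, hj⟩ : ∃ j, IsUnit (b j) := by
        by_contra! hnu
        have hle : Ideal.span (Set.range fun l => ψ (q l)) ≤
            IsLocalRing.maximalIdeal (X.presheaf.stalk x) * Ideal.span {t} := by
          rw [Ideal.span_le]
          rintro _ ⟨l, rfl⟩
          simp only [hb]
          exact Ideal.mul_mem_mul (hnu l) (Ideal.mem_span_singleton_self t)
        obtain ⟨s, hs, hst⟩ := Ideal.mem_mul_span_singleton.mp (hle htJ)
        have : s = 1 := mul_right_cancel₀ ht0 (hst.trans (one_mul t).symm)
        rw [this] at hs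
        exact (Ideal.ne_top_iff_one _).mp (IsLocalRing.maximalIdeal.isMaximal _).ne_top hs
      exact ⟨j, hgen j t b ht0 hb hj, ψ (q j), (hψ m _ (hqh j)).1, fun h => absurd hDx h⟩
    · obtain ⟨j, hj⟩ : ∃ j, IsUnit (ψ (q j)) := by
        by_contra! hnu
        refine hDx (C.specializes_iff.mpr ?_)
        rw [← hT, Ideal.span_le]
        intro p hp
        rw [SetLike.mem_coe, hsum p hp]
        refine Ideal.sum_mem _ fun i _ => ?_
        have h := hnu (⟨p, hp⟩, i, k)
        rw [(hψ m _ (hqh _)).2, not_not] at h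
        exact ((C.isPrime x).mem_or_mem h).resolve_left (C.X_pow_notMem hk _)
      exact ⟨j, hgen j 1 (fun l => ψ (q l)) one_ne_zero (fun l => (mul_one _).symm) hj, ψ (q j),
        (hψ m _ (hqh j)).1, fun _ => hj⟩
  refine ⟨m, ι, inferInstance, f, fun x => ?_, fun z k hz hk => ?_⟩
  · obtain ⟨k, hk⟩ := C.exists_X_notMem x
    obtain ⟨j, hj, -⟩ := main x k hk
    exact ⟨j, hj⟩
  · obtain ⟨j, hj, a, ha, hu⟩ := main z k hk
    refine ⟨j, hj, fun h => ?_, fun h => ?_⟩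
    · rintro rfl
      refine ord_ne_zero_of_vanishesAt hz (div_ne_zero hj.ne_zero
        (pow_ne_zero m (C.coord_ne_zero hk))) ?_ h
      rw [← ha, ← mem_idealOfGenerization specializes_rfl]
      exact (C.mem_idealOfGenerization_iff specializes_rfl hk (hqh j) ha).mpr (hqD j)
    · rw [← ha]
      exact ord_algebraMap_of_isUnit (hu fun h' => not_specializes_of_coheight_eq hD hz h.symm h')

end HomogeneousCoordinates

namespace AlgebraicGeometry.Scheme
variable {X : Scheme.{u}} [IsIntegral X] [IsLocallyNoetherian X]

theorem ord_div_eq_zero_of_notMem_movableSupport {ι : Type*} {f : ι → X.functionField} {z : X}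
    {j : ι} {g : X.functionField} (hz : Order.coheight z = 1) (hj : IsLocalGenerator f z j)
    (hg : g / f j ∈ regularAt z) (h : z ∉ movableSupport f g) : ord (g / f j) z = 0 :=
  ord_eq_zero_of_not_vanishesAt hg fun hv => h ⟨hz, j, hj, hv⟩

end AlgebraicGeometry.Scheme

namespace HomogeneousCoordinates
variable {K : Type u} [Field K] {X : Scheme.{u}} [IsIntegral X] [Algebra K X.functionField] {N : ℕ}
  (C : HomogeneousCoordinates K X N)

include C in
/-- A **moving lemma**: a component `D` of a simple normal crossing divisor is a component of the
divisor of a rational function all of whose other components are new and cross the given divisor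
normally. -/
theorem exists_moving [CharZero K] [IsLocallyNoetherian X] [TopologicalSpace.NoetherianSpace X]
    {S : Set X} (hS : S.Finite) (hSNC : IsSimpleNormalCrossing S) {D : X} (hDS : D ∈ S)
    (hD : Order.coheight D = 1) : ∃ h : X.functionFieldˣ, ord (h : X.functionField) D ≠ 0 ∧
      (∀ z ∈ S, z ≠ D → ord (h : X.functionField) z = 0) ∧
      IsSimpleNormalCrossing (S ∪ divisorSupport h) := by
  have hcoord : ∀ {x : X} {k}, MvPolynomial.X k ∉ C.ideal x → IsLocalGenerator C.coord x k :=
    fun hk => ⟨C.coord_ne_zero hk, C.coord_div_mem_regularAt hk⟩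
  obtain ⟨c, hc0, hcSNC, hcS⟩ := C.exists_isSimpleNormalCrossing_union hS hSNC C.coord
    fun x => (C.exists_X_notMem x).imp fun _ => hcoord
  set ℓ := ∑ l, c l • C.coord l
  set B := movableSupport C.coord ℓ
  obtain ⟨m, ι, _, f, hf, hfD⟩ := C.exists_linearSystem hD fun x h => by
    obtain ⟨d, t, -, -, e, -, he⟩ := hSNC x
    exact ⟨_, he ⟨D, hDS, h⟩⟩
  -- Bertini is applied relative to S ∪ B, so that the new components also cross those of ℓ
  -- normally.
  obtain ⟨b, hb0, hbSNC, hbS⟩ := C.exists_isSimpleNormalCrossing_union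
    (hS.union (finite_movableSupport C.coord hc0)) hcSNC f hf
  set g := ∑ l, b l • f l
  set A := movableSupport f g
  have hord : ∀ z, Order.coheight z = 1 → z ∉ A → z ∉ B → (ord (g / ℓ ^ m) z = 0 ↔ z ≠ D) := by
    intro z hz hzA hzB
    obtain ⟨k, hk⟩ := C.exists_X_notMem z
    obtain ⟨j, hj, hjD⟩ := hfD z k hz hk
    have hy := C.coord_ne_zero hk
    have h1 := ord_div_eq_zero_of_notMem_movableSupport hz hj
      (C.exists_algebraMap_eq_sum_div hj b) hzA
    have h2 := ord_div_eq_zero_of_notMem_movableSupport hz (hcoord hk)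
      (C.exists_algebraMap_eq_sum_div (hcoord hk) c) hzB
    -- Off A and B the outer factors have order 0, so the order is that of f_j / x_k^m, which
    -- detects D.
    rw [← hjD, show g / ℓ ^ m = g / f j * (f j / C.coord k ^ m) / (ℓ / C.coord k) ^ m by
      have := hj.ne_zero
      rw [div_pow]
      field_simp, ord_div (mul_ne_zero (div_ne_zero hb0 hj.ne_zero)
        (div_ne_zero hj.ne_zero (pow_ne_zero m hy))) (pow_ne_zero m (div_ne_zero hc0 hy)),
      ord_mul (div_ne_zero hb0 hj.ne_zero) (div_ne_zero hj.ne_zero (pow_ne_zero m hy)),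
      ord_pow (div_ne_zero hc0 hy), h1, h2, zero_add, mul_zero, sub_zero]
  have hSA : ∀ z ∈ S, z ∉ A := fun z hz => Set.disjoint_left.mp hbS (Or.inl hz)
  have hSB : ∀ z ∈ S, z ∉ B := fun z hz => Set.disjoint_left.mp hcS hz
  refine ⟨Units.mk0 (g / ℓ ^ m) (div_ne_zero hb0 (pow_ne_zero m hc0)),
    fun h => (hord D hD (hSA D hDS) (hSB D hDS)).mp h rfl, fun z hzS hzD => ?_,
    hbSNC.mono (Set.union_subset (fun z hz => Or.inl (Or.inl hz)) fun z hz => ?_)⟩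
  · by_cases hz : Order.coheight z = 1
    · exact (hord z hz (hSA z hzS) (hSB z hzS)).mpr hzD
    · exact ord_eq_zero_of_coheight_neq_one hz _
  · by_contra h
    simp only [Set.mem_union, not_or] at h
    have hz1 : Order.coheight z = 1 := by
      by_contra hz1
      exact hz (ord_eq_zero_of_coheight_neq_one hz1 _)
    refine hz ((hord z hz1 h.2 h.1.2).mpr ?_)
    rintro rfl
    exact h.1.1 hDS

end HomogeneousCoordinates

/-! ### Separation of overlaps -/

section Separation
variable {P E M W ι : Type*} [AddCommGroup E] [AddCommGroup M] [Module ℚ M] [AddCommGroup W]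
  [Module ℚ W] [Fintype ι] [DecidableEq ι] (ord : P → E →+ ℤ) (u : E →+ M) (A : M [⋀^ι]→ₗ[ℚ] W)

/-- The incidences of common zeros or poles of two members of a family. -/
def overlaps (f : ι → E) : Set (ι × ι × P) :=
  {t | t.1 ≠ t.2.1 ∧ ord t.2.2 (f t.1) ≠ 0 ∧ ord t.2.2 (f t.2.1) ≠ 0}

variable {ord}

omit [DecidableEq ι] in
theorem finite_overlaps (hfin : ∀ e, {z | ord z e ≠ 0}.Finite) (f : ι → E) :
    (overlaps ord f).Finite :=
  (Set.finite_univ.prod (Set.finite_univ.prod (Set.finite_iUnion fun i => hfin (f i)))).subset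
    fun t ht => ⟨trivial, trivial, Set.mem_iUnion.mpr ⟨t.1, ht.2.1⟩⟩

omit [Fintype ι] in
theorem overlaps_update_subset {f : ι → E} {i : ι} {x : E}
    (h : ∀ q ≠ i, ∀ z, ord z x ≠ 0 → ord z (f q) ≠ 0 → ord z (f i) ≠ 0) :
    overlaps ord (Function.update f i x) ⊆ overlaps ord f := by
  rintro ⟨p, q, z⟩ ⟨hpq, hp, hq⟩
  refine ⟨hpq, ?_⟩
  rcases eq_or_ne p i with rfl | hpi
  · simp only [Function.update_self, Function.update_of_ne hpq.symm] at hp hq ⊢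
    exact ⟨h q hpq.symm z hp hq, hq⟩
  · rcases eq_or_ne q i with rfl | hqi
    · simp only [Function.update_self, Function.update_of_ne hpq] at hp hq ⊢
      exact ⟨hp, h p hpq z hq hp⟩
    · simp only [Function.update_of_ne hpi, Function.update_of_ne hqi] at hp hq ⊢
      exact ⟨hp, hq⟩

variable {A u} in
/-- Exchanging one member of a family for an element `h` whose only zero or pole in common with the
others is `D` changes the family by families with fewer overlaps. -/
theorem exists_exchange (hfin : ∀ e, {z | ord z e ≠ 0}.Finite) {T : Set P} {f : ι → E}
    (hf : ∀ q z, ord z (f q) ≠ 0 → z ∈ T) {i j : ι} (hij : i ≠ j) {D : P} (hi : ord D (f i) ≠ 0)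
    (hj : ord D (f j) ≠ 0) {h : E} (hh : ∀ z, ord z h ≠ 0 → z ∈ T)
    (hfresh : ∀ q ≠ i, ∀ z ≠ D, ord z h ≠ 0 → ord z (f q) = 0) :
    (overlaps ord (Function.update f i h)).ncard ≤ (overlaps ord f).ncard ∧
    (∀ q z, ord z (Function.update f i h q) ≠ 0 → z ∈ T) ∧
    ∃ g : ι → E, (overlaps ord g).ncard < (overlaps ord f).ncard ∧
      (∀ q z, ord z (g q) ≠ 0 → z ∈ T) ∧
      (ord D h : ℚ) • A (u ∘ f) - (ord D (f i) : ℚ) • A (u ∘ Function.update f i h) =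
        A (u ∘ g) := by
  have hT : ∀ x, (∀ z, ord z x ≠ 0 → z ∈ T) → ∀ q z, ord z (Function.update f i x q) ≠ 0 →
      z ∈ T := fun x hx q z hz => by
    rcases eq_or_ne q i with rfl | hq
    · rw [Function.update_self] at hz; exact hx z hz
    · rw [Function.update_of_ne hq] at hz; exact hf q z hz
  refine ⟨Set.ncard_le_ncard (overlaps_update_subset fun q hq z hz hz' => ?_)
    (finite_overlaps hfin f), hT h hh, Function.update f i (ord D h • f i - ord D (f i) • h),
    Set.ncard_lt_ncard ⟨overlaps_update_subset fun q hq z hz hz' => ?_, fun hle => ?_⟩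
    (finite_overlaps hfin f), hT _ fun z hz => ?_, ?_⟩
  · by_cases hzD : z = D
    · rwa [hzD]
    · exact absurd (hfresh q hq z hzD hz) hz'
  · by_cases hzD : z = D
    · rwa [hzD]
    · intro h0
      have : ord z h ≠ 0 := fun h1 => hz (by simp [h0, h1])
      exact absurd (hfresh q hq z hzD this) hz'
  -- The new entry has order ord_D(h) ord_D(f_i) - ord_D(f_i) ord_D(h) = 0 at D, so this overlap is
  -- lost.
  · have := (hle (show (i, j, D) ∈ overlaps ord f from ⟨hij, hi, hj⟩)).2.1
    simp [mul_comm] at this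
  · by_contra hzT
    have h0 := not_not.mp (mt (hf i z) hzT)
    have h1 := not_not.mp (mt (hh z) hzT)
    exact hz (by simp [h0, h1])
  · simp only [Function.comp_update, map_sub, map_zsmul, AlternatingMap.map_update_sub]
    simp only [← Int.cast_smul_eq_zsmul ℚ, AlternatingMap.map_update_smul]
    congr 2
    exact congrArg A (Function.update_eq_self i (u ∘ f)).symm

/-- Separation of overlaps: if the support of a family belongs to a class of sets in which every
point can be moved, then its alternating product is a linear combination of products of families in
the class whose members have pairwise disjoint supports. -/
theorem mem_span_of_moving (hfin : ∀ e, {z | ord z e ≠ 0}.Finite) {Snc : Set P → Prop}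
    (hmono : ∀ ⦃S T⦄, Snc T → S ⊆ T → Snc S)
    (hmove : ∀ S : Set P, S.Finite → Snc S → ∀ D ∈ S, (∃ e, ord D e ≠ 0) →
      ∃ h, ord D h ≠ 0 ∧ (∀ z ∈ S, z ≠ D → ord z h = 0) ∧ Snc (S ∪ {z | ord z h ≠ 0}))
    (f : ι → E) (hf : Snc (⋃ i, {z | ord z (f i) ≠ 0})) :
    A (u ∘ f) ∈ Submodule.span ℚ {ω | ∃ g : ι → E, (Snc (⋃ i, {z | ord z (g i) ≠ 0}) ∧
      Pairwise fun i j => Disjoint {z | ord z (g i) ≠ 0} {z | ord z (g j) ≠ 0}) ∧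
      ω = A (u ∘ g)} := by
  set Good := Submodule.span ℚ {ω | ∃ g : ι → E, (Snc (⋃ i, {z | ord z (g i) ≠ 0}) ∧
      Pairwise fun i j => Disjoint {z | ord z (g i) ≠ 0} {z | ord z (g j) ≠ 0}) ∧
      ω = A (u ∘ g)}
  induction hN : (overlaps ord f).ncard using Nat.strong_induction_on generalizing f with
  | _ N IH =>
  by_cases hdisj : Pairwise fun i j => Disjoint {z | ord z (f i) ≠ 0} {z | ord z (f j) ≠ 0}
  · exact Submodule.subset_span ⟨f, ⟨hf, hdisj⟩, rfl⟩
  simp only [_root_.Pairwise, Set.disjoint_left, Set.mem_ofPred_eq, not_forall, not_not] at hdisj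
  obtain ⟨i, j, hij, D, hi, hj⟩ := hdisj
  set S := ⋃ i, {z | ord z (f i) ≠ 0}
  have hS : S.Finite := Set.finite_iUnion fun i => hfin (f i)
  have hmem : ∀ q z, ord z (f q) ≠ 0 → z ∈ S := fun q z hz => Set.mem_iUnion.mpr ⟨q, hz⟩
  -- Each function is chosen after the supports of the previous ones are added, so any two of the
  -- three share only D. All later families have support inside the one admissible set `T`.
  obtain ⟨h₁, hD₁, hz₁, hS₁⟩ := hmove S hS hf D (hmem i D hi) ⟨_, hi⟩
  obtain ⟨h₂, hD₂, hz₂, hS₂⟩ := hmove _ (hS.union (hfin h₁)) hS₁ D (Or.inl (hmem i D hi)) ⟨_, hi⟩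
  obtain ⟨h₃, hD₃, hz₃, hS₃⟩ := hmove _ ((hS.union (hfin h₁)).union (hfin h₂)) hS₂ D
    (Or.inl (Or.inl (hmem i D hi))) ⟨_, hi⟩
  set T := S ∪ {z | ord z h₁ ≠ 0} ∪ {z | ord z h₂ ≠ 0} ∪ {z | ord z h₃ ≠ 0}
  have hT₁ : ∀ z, ord z h₁ ≠ 0 → z ∈ T := fun z hz => Or.inl (Or.inl (Or.inr hz))
  have hT₂ : ∀ z, ord z h₂ ≠ 0 → z ∈ T := fun z hz => Or.inl (Or.inr hz)
  have hT₃ : ∀ z, ord z h₃ ≠ 0 → z ∈ T := fun z hz => Or.inr hz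
  have hf₁ : ∀ q, ∀ z ≠ D, ord z h₁ ≠ 0 → ord z (f q) = 0 := fun q z hz h => by
    by_contra h'; exact h (hz₁ z (hmem q z h') hz)
  have hf₂ : ∀ q, ∀ z ≠ D, ord z h₂ ≠ 0 → ord z (f q) = 0 := fun q z hz h => by
    by_contra h'; exact h (hz₂ z (Or.inl (hmem q z h')) hz)
  have hf₃ : ∀ q, ∀ z ≠ D, ord z h₃ ≠ 0 → ord z (f q) = 0 := fun q z hz h => by
    by_contra h'; exact h (hz₃ z (Or.inl (Or.inl (hmem q z h'))) hz)
  have h₁₂ : ∀ z ≠ D, ord z h₂ ≠ 0 → ord z h₁ = 0 := fun z hz h => by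
    by_contra h'; exact h (hz₂ z (Or.inr h') hz)
  have h₁₃ : ∀ z ≠ D, ord z h₃ ≠ 0 → ord z h₁ = 0 := fun z hz h => by
    by_contra h'; exact h (hz₃ z (Or.inl (Or.inr h')) hz)
  have h₂₃ : ∀ z ≠ D, ord z h₃ ≠ 0 → ord z h₂ = 0 := fun z hz h => by
    by_contra h'; exact h (hz₃ z (Or.inr h') hz)
  -- One exchange modulo `Good`. The bound `N` and the support condition are inherited by the
  -- exchanged family, so exchanges can be chained.
  have key : ∀ g : ι → E, (overlaps ord g).ncard ≤ N → (∀ q z, ord z (g q) ≠ 0 → z ∈ T) →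
      ∀ i j, i ≠ j → ord D (g i) ≠ 0 → ord D (g j) ≠ 0 → ∀ h, (∀ z, ord z h ≠ 0 → z ∈ T) →
      (∀ q ≠ i, ∀ z ≠ D, ord z h ≠ 0 → ord z (g q) = 0) →
      (overlaps ord (Function.update g i h)).ncard ≤ N ∧
      (∀ q z, ord z (Function.update g i h q) ≠ 0 → z ∈ T) ∧
      (ord D h : ℚ) • A (u ∘ g) - (ord D (g i) : ℚ) • A (u ∘ Function.update g i h) ∈ Good := by
    intro g hgN hgT i j hij hi hj h hhT hfresh
    obtain ⟨h1, h2, k, hk, hkT, hkA⟩ := exists_exchange (A := A) (u := u) hfin hgT hij hi hj hhT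
      hfresh
    exact ⟨h1.trans hgN, h2, hkA ▸ IH _ (hk.trans_le hgN) k (hmono hS₃
      (Set.iUnion_subset hkT)) rfl⟩
  obtain ⟨hN₁, hU₁, hA₁⟩ := key f hN.le (fun q z hz => Or.inl (Or.inl (Or.inl (hmem q z hz)))) i j
    hij hi hj h₁ hT₁ fun q _ => hf₁ q
  obtain ⟨hN₂, hU₂, hA₂⟩ := key _ hN₁ hU₁ j i hij.symm (by simpa [hij.symm] using hj) (by simpa)
    h₂ hT₂ fun q hq z hz h => by
      rcases eq_or_ne q i with rfl | hqi
      · simpa using h₁₂ z hz h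
      · simpa [hqi] using hf₂ q z hz h
  obtain ⟨hN₃, hU₃, hA₃⟩ := key _ hN₂ hU₂ i j hij (by simpa [hij]) (by simpa)
    h₃ hT₃ fun q hq z hz h => by
      rcases eq_or_ne q j with rfl | hqj
      · simpa using h₂₃ z hz h
      · simpa [hqj, hq] using hf₃ q z hz h
  obtain ⟨hN₄, hU₄, hA₄⟩ := key _ hN₃ hU₃ j i hij.symm (by simpa [hij.symm]) (by simpa)
    h₁ hT₁ fun q hq z hz h => by
      rcases eq_or_ne q i with rfl | hqi
      · simpa using not_not.mp (mt (h₁₃ z hz) h)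
      · simpa [hqi, hq] using hf₁ q z hz h
  obtain ⟨-, -, hA₅⟩ := key _ hN₄ hU₄ i j hij (by simpa [hij]) (by simpa)
    h₂ hT₂ fun q hq z hz h => by
      rcases eq_or_ne q j with rfl | hqj
      · simpa using h₁₂ z hz h
      · simpa [hqj, hq] using hf₂ q z hz h
  simp only [ne_eq, hij, hij.symm, not_false_eq_true, Function.update_of_ne, Function.update_self,
    Function.update_comm hij.symm, Function.update_idem] at hA₂ hA₃ hA₄ hA₅
  have hswap : A (u ∘ Function.update (Function.update f i h₂) j h₁) =
      -A (u ∘ Function.update (Function.update f i h₁) j h₂) := by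
    rw [← A.map_swap _ hij]
    congr 1
    funext q
    rcases eq_or_ne q i with rfl | hqi
    · simp [hij]
    · rcases eq_or_ne q j with rfl | hqj
      · simp [hij]
      · simp [hqi, hqj, Equiv.swap_apply_of_ne_of_ne]
  rw [hswap] at hA₅
  have hc : ∀ {h}, ord D h ≠ 0 → (ord D h : ℚ) ≠ 0 := fun h => Int.cast_ne_zero.mpr h
  -- The cycle (h₁, h₂), (h₃, h₂), (h₃, h₁), (h₂, h₁): the intermediate terms cancel in the sum, and
  -- the sign of the swap turns the two ends into 2 ord_D(h₃) times the same product.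
  have h12 : A (u ∘ Function.update (Function.update f i h₁) j h₂) ∈ Good := by
    rw [← Good.smul_mem_iff (mul_ne_zero two_ne_zero (hc hD₃))]
    convert! add_mem (add_mem hA₃ hA₄) hA₅ using 1
    module
  have h1 := (Good.sub_mem_iff_left (Good.smul_mem _ h12)).mp hA₂
  rw [Good.smul_mem_iff (hc hD₂)] at h1
  have h0 := (Good.sub_mem_iff_left (Good.smul_mem _ h1)).mp hA₁
  rwa [Good.smul_mem_iff (hc hD₁)] at h0

end Separation

/-! ### Conclusion -/

theorem noetherianSpace_of_isClosedImmersion {K : Type u} [Field K] {N : ℕ} {X : Scheme.{u}}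
    [IsLocallyNoetherian X] (i : X ⟶ projectiveSpace K N) [IsClosedImmersion i] :
    TopologicalSpace.NoetherianSpace X := by
  have : CompactSpace X := i.isClosedEmbedding.compactSpace
  have : IsNoetherian X := ⟨⟩
  infer_instance

/-- The order at a point, as a homomorphism on the multiplicative group of the function field. -/
def ordAddHom {X : Scheme.{u}} [IsIntegral X] [IsLocallyNoetherian X] (z : X) :
    Additive X.functionFieldˣ →+ ℤ where
  toFun e := ord (e.toMul : X.functionField) z
  map_zero' := by simpa using ord_pow (x := z) (one_ne_zero (α := X.functionField)) 0
  map_add' a b := ord_mul a.toMul.ne_zero b.toMul.ne_zero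

end

theorem mainTheorem10 {K : Type u} [Field K] [CharZero K] (V : SmoothProjectiveVariety K) (n : ℕ)
    (f : Fin n → (V.X.functionField)ˣ) (hf : WeaklyAdmissible f) :
    wedge f ∈ Submodule.span ℚ
      {ω : RationalWedge V.X.functionField n |
        ∃ g : Fin n → (V.X.functionField)ˣ, StrictlyAdmissible g ∧ ω = wedge g} := by
  obtain ⟨N, i, hi, -⟩ := V.projective
  obtain ⟨_, ⟨C⟩⟩ := IsClosedImmersion.exists_homogeneousCoordinates i
  have := noetherianSpace_of_isClosedImmersion i
  exact mem_span_of_moving (ord := ordAddHom (X := V.X))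
    (TensorProduct.mk ℤ ℚ (Additive V.X.functionFieldˣ) 1).toAddMonoidHom
    (exteriorPower.ιMulti ℚ n) (fun e => Scheme.finite_ord_ne_zero e.toMul.ne_zero)
    (Snc := IsSimpleNormalCrossing) (fun S T hT hST => hT.mono hST)
    (fun S hS hSNC D hDS ⟨e, he⟩ => by
      -- The normal crossing predicate makes sense for any set of points; that D has codimension one
      -- follows from some function having nonzero order there.
      obtain ⟨h, hD, hz, hh⟩ := C.exists_moving hS hSNC hDS (by
        by_contra h
        exact he (Scheme.ord_eq_zero_of_coheight_neq_one h _))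
      exact ⟨Additive.ofMul h, hD, hz, hh⟩) (fun i => Additive.ofMul (f i)) hf
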